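/- **Conventions.** All nets are indexed by one directed set. A *compact measured metric space* is a compact metric space with a finite Borel measure of full support; $|A|$ denotes the measure of $A$, $dx$ integration with respect to it, and $B(x,r)$ an open ball. For $p\ge 1$, a measured space $M$ and a pointed metric space $(Y,y)$, $L^p_y(M,Y)$ is the space of (a.e. classes of) measurable maps $u:M\to Y$ with $d_{L^p}(u,y)<\infty$, where $d_{L^p}(u,v)=(\int_M d_Y(u(x),v(x))^p\,dx)^{1/p}$. *Convergence of the domains.* $M_i\to M$ in the measured Gromov–Hausdorff sense means that there are Borel maps $\varphi_i:M_i\to M$ with distortion tending to $0$, with $\varphi_i(M_i)$ being $\epsilon_i$-dense in $M$ for some $\epsilon_i\to0$, and with $\int_{M_i} f\circ\varphi_i\,dx\to\int_M f\,dx$ for all $f\in C(M)$. *$L^p$-topology.* Let $(Y_i,y_i)\to(Y,y_0)$ be proper pointed metric spaces converging in the pointed Gromov–Hausdorff sense. Embed all $Y_i$ and $Y$ isometrically into a real Banach space $\mathbb B$ so that $y_i\to y_0$ and $Y_i\to Y$ in the Hausdorff sense on bounded subsets of $\mathbb B$ (this is possible). The $L^p$-topology on $\bigl(\bigsqcup_i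 L^p_{y_i}(M_i,Y_i)\bigr)\sqcup L^p_{y_0}(M,Y)$ is the restriction, under $u\mapsto u-y_i$ and $u\mapsto u-y_0$, of the topology on $\bigl(\bigsqcup_i L^p_0(M_i,\mathbb B)\bigr)\sqcup L^p_0(M,\mathbb B)$ generated by the open sets of the metric spaces $L^p_0(M_i,\mathbb B)$ together with the sets $\{v\in L^p_0(M,\mathbb B): d_{L^p}(v,g)<\delta\}\cup\bigcup_{i\ge i_0}\{v\in L^p_0(M_i,\mathbb B): d_{L^p}(v,g\circ\varphi_i)<\delta\}$, where $g:M\to\mathbb B$ is continuous, $\delta>0$ and $i_0$ is an index. Thus a net $u_i\in L^p_0(M_i,\mathbb B)$ converges to $u\in L^p_0(M,\mathbb B)$ iff there are continuous $g_j:M\to\mathbb B$ with $d_{L^p}(g_j,u)\to0$ and $\lim_j\limsup_i d_{L^p}(u_i,g_j\circ\varphi_i)=0$. *Asymptotic compactness.* Functionals $E_i:L^p_{y_i}(M_i,Y_i)\to[0,\infty]$ are asymptotically compact if every net $u_i\in L^p_{y_i}(M_i,Y_i)$ such that $\limsup_i E_i(u_i)<\infty$ and $d_{L^p}(u_i,v_i)$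 is bounded for some net $v_i\in L^p_{y_i}(M_i,Y_i)$ converging to an element of $L^p_{y_0}(M,Y)$ has a subnet converging to an element of $L^p_{y_0}(M,Y)$. *Local covering order.* For $c\ge 1$ and $r>0$, $K_{c,M}(r)$ is the supremum, over all $D\subset M$ whose distinct points are at distance $\ge r$ and all $x\in M$, of the number of $z\in D$ with $x\in B(z,cr)$. The $c$-local covering order of $M$ is at most $f(r)$ if $K_{c,M}(r)\le f(r)$ for all $r>0$. *Poincaré inequality.* A functional $E:L^p_y(M,Y)\to[0,\infty]$ satisfies $(P)_{p,c,C,\rho,R}$ if for every $u$ with $E(u)<\infty$ there is a finitely additive $\mu_u:\mathcal B(M)\to[0,\infty)$ on the Borel sets with $\mu_u(M)\le E(u)$ and $$\frac1{|B(x,r)|}\iint_{B(x,r)\times B(x,r)} d_Y(u(a),u(b))^p\,da\,db\le C\,r^p\,\mu_u(B(x,cr))\qquad\text{for all }x\in M,\ r\in(\rho,R].$$ **Theorem.** Let $M_i\to M$ be compact measured metric spaces converging in the measured Gromov–Hausdorff sense, realized by maps $\varphi_i$ as above, let $(Y_i,y_i)\to(Y,y_0)$ be proper pointed metric spaces converging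 in the pointed Gromov–Hausdorff sense, and let an embedding into a Banach space as above be given. Let $p,c\ge1$ and $C,R>0$ be constants, and assume that the $c$-local covering order of $M$ is at most some function $f(r)$ with $f(r)=o(r^{-p})$ as $r\to0^+$. Let $E_i:L^p_{y_i}(M_i,Y_i)\to[0,\infty]$ be a net of functionals such that each $E_i$ satisfies $(P)_{p,c,C,\rho_i,R}$, where $0\le\rho_i\le R$ and $\rho_i\to0$. Then $\{E_i\}$ is asymptotically compact for the $L^p$-topology. -/

import Mathlib

open MeasureTheory Filter Topology
open scoped ENNReal NNReal

universe uI uM uM₀ uY uY₀ uB uX uX₀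

noncomputable section

/-! ### Gromov-Hausdorff convergence -/

/-- `f` is a (not necessarily continuous) `ε`-approximation: its distortion
`sup |d(f x, f x') - d(x, x')|` is smaller than `ε` and the open `ε`-neighbourhood of its image is
the whole space. -/
def IsGHApprox {X : Type uX} {X₀ : Type uX₀} [MetricSpace X] [MetricSpace X₀]
    (ε : ℝ) (f : X → X₀) : Prop :=
  (∃ δ < ε, ∀ x x' : X, |dist (f x) (f x') - dist x x'| ≤ δ) ∧
    ∀ z : X₀, ∃ x : X, dist z (f x) < ε

/-- The net `φ i : M i → M₀` realizes the measured Gromov-Hausdorff convergence of the compact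
measured metric spaces `(M i, μ i)` to `(M₀, μ₀)`: it consists of measurable `ε i`-approximations
with `ε i → 0`, and the push-forward measures converge weakly to `μ₀`. -/
structure IsMeasuredGHApprox {I : Type uI} [Preorder I] {M : I → Type uM} {M₀ : Type uM₀}
    [∀ i, MetricSpace (M i)] [∀ i, MeasurableSpace (M i)] [MetricSpace M₀] [MeasurableSpace M₀]
    (μ : ∀ i, Measure (M i)) (μ₀ : Measure M₀) (φ : ∀ i, M i → M₀) : Prop where
  measurable : ∀ i, Measurable (φ i)
  approx : ∀ ε : ℝ, 0 < ε → ∀ᶠ i in atTop, IsGHApprox ε (φ i)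
  weak : ∀ f : C(M₀, ℝ),
    Tendsto (fun i => ∫ x, f (φ i x) ∂(μ i)) atTop (𝓝 (∫ x, f x ∂μ₀))

/-- Pointed Gromov-Hausdorff convergence `(Y i, y i) → (Y₀, y₀)`. -/
def PointedGHTendsto {I : Type uI} [Preorder I] {Y : I → Type uY} {Y₀ : Type uY₀}
    [∀ i, MetricSpace (Y i)] [MetricSpace Y₀] (y : ∀ i, Y i) (y₀ : Y₀) : Prop :=
  ∃ ψ : ∀ i, Y i → Y₀, (∀ i, ψ i (y i) = y₀) ∧
    ∀ r : ℝ, 0 < r → ∀ ε : ℝ, 0 < ε → ∀ᶠ i in atTop,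
      (∀ x ∈ Metric.ball (y i) r, ∀ x' ∈ Metric.ball (y i) r,
        |dist (ψ i x) (ψ i x') - dist x x'| < ε) ∧
      ∀ z ∈ Metric.ball y₀ r, ∃ x ∈ Metric.ball (y i) (r + ε), dist z (ψ i x) < ε

/-- Convergence of the subsets `A i` to `A₀` with respect to the Hausdorff distance on bounded
parts of the metric space `Z`. -/
def CompactHausdorffTendsto {I : Type uI} [Preorder I] {Z : Type uB} [PseudoMetricSpace Z]
    (A : I → Set Z) (A₀ : Set Z) : Prop :=
  ∀ (o : Z) (r ε : ℝ), 0 < r → 0 < ε → ∀ᶠ i in atTop,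
    A i ∩ Metric.ball o r ⊆ Metric.thickening ε A₀ ∧
      A₀ ∩ Metric.ball o r ⊆ Metric.thickening ε (A i)

/-- Isometric embeddings of all `Y i` and of `Y₀` into one real Banach space `𝔹` which realize the
pointed Gromov-Hausdorff convergence `(Y i, y i) → (Y₀, y₀)` as Hausdorff convergence inside `𝔹`. -/
structure IsGHEmbedding {I : Type uI} [Preorder I] {Y : I → Type uY} {Y₀ : Type uY₀}
    [∀ i, MetricSpace (Y i)] [MetricSpace Y₀] {𝔹 : Type uB} [NormedAddCommGroup 𝔹]
    (y : ∀ i, Y i) (y₀ : Y₀) (α : ∀ i, Y i → 𝔹) (α₀ : Y₀ → 𝔹) : Prop where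
  isometry : ∀ i, Isometry (α i)
  isometry₀ : Isometry α₀
  base : Tendsto (fun i => α i (y i)) atTop (𝓝 (α₀ y₀))
  hausdorff : CompactHausdorffTendsto (fun i => Set.range (α i)) (Set.range α₀)

/-! ### `L^p`-mapping spaces -/

/-- The `L^p`-distance `(∫ d(u(x), v(x))^p dx)^(1/p)`, with values in `[0, ∞]`. -/
def lpDist {M : Type uM} {Y : Type uY} [MeasurableSpace M] [MetricSpace Y]
    (p : ℝ) (μ : Measure M) (u v : M → Y) : ℝ≥0∞ :=
  (∫⁻ x, edist (u x) (v x) ^ p ∂μ) ^ (1 / p)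

/-- The space `L^p_y(M, Y)` of (a.e. classes of) measurable maps `M → Y` at finite `L^p`-distance
from the constant map `y`. -/
def LpMap {M : Type uM} {Y : Type uY} [MeasurableSpace M] [MetricSpace Y]
    (p : ℝ) (μ : Measure M) (y : Y) : Type (max uM uY) :=
  {u : M →ₘ[μ] Y // lpDist p μ u (fun _ => y) < ∞}

/-- The embedding `u ↦ a ∘ u - a(y)` of `L^p_y(M, Y)` into `L^p_0(M, 𝔹)` induced by an isometric
embedding `a : Y → 𝔹`. -/
def LpMap.embed {M : Type uM} {Y : Type uY} [MeasurableSpace M] [MetricSpace Y]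
    {𝔹 : Type uB} [NormedAddCommGroup 𝔹] {p : ℝ} {μ : Measure M} {y : Y}
    (a : Y → 𝔹) (ha : Isometry a) (u : LpMap p μ y) : LpMap p μ (0 : 𝔹) :=
  ⟨AEEqFun.comp (fun z => a z - a y) (ha.continuous.sub continuous_const) u.1, by
    have h : lpDist p μ (AEEqFun.comp (fun z => a z - a y)
        (ha.continuous.sub continuous_const) u.1) (fun _ => (0 : 𝔹)) =
        lpDist p μ u.1 (fun _ => y) := by
      unfold lpDist
      congr 1
      refine lintegral_congr_ae ?_
      filter_upwards [AEEqFun.coeFn_comp (fun z => a z - a y)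
        (ha.continuous.sub continuous_const) u.1] with x hx
      rw [hx, ← ha.edist_eq (u.1 x) y]
      simp [edist_eq_enorm_sub]
    rw [h]
    exact u.2⟩

/-- The `L^p`-topology on the disjoint union of the `L^p_0(M i, 𝔹)` and of `L^p_0(M₀, 𝔹)`. A basic
neighbourhood of a point of `L^p_0(M₀, 𝔹)` consists, for some continuous `g : M₀ → 𝔹`, of the maps
`L^p`-close to `g` on `M₀` and of the maps `L^p`-close to `g ∘ φ i` on `M i` for all `i ≥ i₀`; each
`L^p_0(M i, 𝔹)` is open and carries its metric topology. (As `M₀` is compact in all uses, every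
continuous map on it has compact support.) -/
@[reducible] def banachLpTopology {I : Type uI} [Preorder I] {M : I → Type uM} {M₀ : Type uM₀}
    [∀ i, MeasurableSpace (M i)] [TopologicalSpace M₀] [MeasurableSpace M₀]
    {𝔹 : Type uB} [NormedAddCommGroup 𝔹]
    (p : ℝ) (μ : ∀ i, Measure (M i)) (μ₀ : Measure M₀) (φ : ∀ i, M i → M₀) :
    TopologicalSpace ((Σ i, LpMap p (μ i) (0 : 𝔹)) ⊕ LpMap p μ₀ (0 : 𝔹)) :=
  TopologicalSpace.generateFrom
    ({O | ∃ (i : I) (w : LpMap p (μ i) (0 : 𝔹)) (δ : ℝ≥0∞),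
        O = (fun v => Sum.inl ⟨i, v⟩) '' {v : LpMap p (μ i) (0 : 𝔹) |
          lpDist p (μ i) v.1 w.1 < δ}} ∪
      {O | ∃ (g : C(M₀, 𝔹)) (δ : ℝ≥0∞) (i₀ : I),
        O = (Sum.inl '' {s : Σ i, LpMap p (μ i) (0 : 𝔹) |
              i₀ ≤ s.1 ∧ lpDist p (μ s.1) s.2.1 (fun x => g (φ s.1 x)) < δ}) ∪
            (Sum.inr '' {v : LpMap p μ₀ (0 : 𝔹) | lpDist p μ₀ v.1 g < δ})})

/-- The `L^p`-topology on the disjoint union of the `L^p_{y i}(M i, Y i)` and of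
`L^p_{y₀}(M₀, Y₀)`: the restriction of the one for maps into the Banach space `𝔹`. -/
@[reducible] def lpTopology {I : Type uI} [Preorder I] {M : I → Type uM} {M₀ : Type uM₀}
    [∀ i, MeasurableSpace (M i)] [TopologicalSpace M₀] [MeasurableSpace M₀]
    {Y : I → Type uY} {Y₀ : Type uY₀} [∀ i, MetricSpace (Y i)] [MetricSpace Y₀]
    {𝔹 : Type uB} [NormedAddCommGroup 𝔹]
    (p : ℝ) (μ : ∀ i, Measure (M i)) (μ₀ : Measure M₀) (φ : ∀ i, M i → M₀)
    {y : ∀ i, Y i} {y₀ : Y₀} {α : ∀ i, Y i → 𝔹} {α₀ : Y₀ → 𝔹} (hα : IsGHEmbedding y y₀ α α₀) :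
    TopologicalSpace ((Σ i, LpMap p (μ i) (y i)) ⊕ LpMap p μ₀ y₀) :=
  TopologicalSpace.induced
    (Sum.map (fun s => ⟨s.1, s.2.embed (α s.1) (hα.isometry s.1)⟩)
      (fun u => u.embed α₀ hα.isometry₀))
    (banachLpTopology (𝔹 := 𝔹) p μ μ₀ φ)

/-! ### Asymptotic compactness -/

/-- Asymptotic compactness of a net of functionals `E i : X i → [0, ∞]` with respect to a topology
`τ` on the disjoint union of the spaces `X i` (with distances `d i`) and of `X₀`: every net
`x i ∈ X i` which is bounded (at bounded distance from some net converging to a point of `X₀`) and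
has `limsup E i (x i) < ∞` possesses a subnet converging to a point of `X₀`. -/
def AsymptoticallyCompact {I : Type uI} [Preorder I] {X : I → Type uX} {X₀ : Type uX₀}
    (d : ∀ i, X i → X i → ℝ≥0∞) (τ : TopologicalSpace ((Σ i, X i) ⊕ X₀))
    (E : ∀ i, X i → ℝ≥0∞) : Prop :=
  ∀ x : ∀ i, X i,
    (∃ (o : ∀ i, X i) (o₀ : X₀),
      Tendsto (fun i => (Sum.inl ⟨i, o i⟩ : (Σ i, X i) ⊕ X₀)) atTop (@nhds _ τ (Sum.inr o₀)) ∧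
      ∃ b : ℝ≥0, ∀ i, d i (x i) (o i) ≤ b) →
    limsup (fun i => E i (x i)) atTop < ∞ →
    ∃ (J : Type uI) (_ : Preorder J) (_ : IsDirectedOrder J) (_ : Nonempty J) (h : J → I)
      (x₀ : X₀),
      Tendsto h atTop atTop ∧
      Tendsto (fun j => (Sum.inl ⟨h j, x (h j)⟩ : (Σ i, X i) ⊕ X₀)) atTop
        (@nhds _ τ (Sum.inr x₀))

/-! ### Local covering order and the Poincaré inequality -/

/-- `K_{c,S}(r)`: the supremum, over all `r`-separated subsets `D` of `S` and all points `x`, of the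
number of centres `z ∈ D` whose open ball `B(z, c r)` contains `x`. -/
def coveringOrder (S : Type uM) [MetricSpace S] (c r : ℝ) : ℕ∞ :=
  ⨆ (D : Set S) (_ : D.Pairwise fun a b => r ≤ dist a b) (x : S),
    {z ∈ D | x ∈ Metric.ball z (c * r)}.encard

/-- The `c`-local covering order of `S` is at most `f(r)`. -/
def LocalCoveringOrderLE (S : Type uM) [MetricSpace S] (c : ℝ) (f : ℝ → ℝ) : Prop :=
  ∀ r : ℝ, 0 < r → (coveringOrder S c r : ℝ≥0∞) ≤ ENNReal.ofReal (f r)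

/-- `ν` is finitely additive on Borel sets. -/
def IsFinitelyAdditive {M : Type uM} [MeasurableSpace M] (ν : Set M → ℝ≥0) : Prop :=
  ∀ A B : Set M, MeasurableSet A → MeasurableSet B → Disjoint A B → ν (A ∪ B) = ν A + ν B

/-- The weak Poincaré inequality `(P)_{p,c,C,ρ,R}` for a functional `E` on `L^p_y(M, Y)`. -/
def WeakPoincare {M : Type uM} {Y : Type uY} [MetricSpace M] [MeasurableSpace M] [MetricSpace Y]
    {p : ℝ} {μ : Measure M} {y : Y} (c C ρ R : ℝ) (E : LpMap p μ y → ℝ≥0∞) : Prop :=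
  ∀ u : LpMap p μ y, E u < ∞ →
    ∃ ν : Set M → ℝ≥0, IsFinitelyAdditive ν ∧ (ν Set.univ : ℝ≥0∞) ≤ E u ∧
      ∀ x : M, ∀ r ∈ Set.Ioc ρ R,
        (μ (Metric.ball x r))⁻¹ *
            (∫⁻ a in Metric.ball x r, ∫⁻ b in Metric.ball x r,
              edist (u.1 a) (u.1 b) ^ p ∂μ ∂μ) ≤
          ENNReal.ofReal (C * r ^ p) * (ν (Metric.ball x (c * r)) : ℝ≥0∞)


section Existence

variable {I : Type uI} {Y : I → Type uY} {Y₀ : Type uY₀} [∀ i, MetricSpace (Y i)] [MetricSpace Y₀]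

/-- Families of `1`-Lipschitz functions on `Y₀` and on all `Y i` that differ by at most `ε` across
every triple `(x, w, ε)` of the relation `B i`. -/
def BridgedFamily (B : ∀ i, Y i → Y₀ → ℝ → Prop) : Type (max uI uY uY₀) :=
  {t : (Y₀ → ℝ) × (∀ i, Y i → ℝ) //
    (∀ z z', t.1 z - t.1 z' ≤ dist z z') ∧ (∀ i x x', t.2 i x - t.2 i x' ≤ dist x x') ∧
    ∀ i x w ε, B i x w ε → |t.2 i x - t.1 w| ≤ ε}

theorem exists_lipschitz_transfer {A : Type uX} {B : Type uX₀} [MetricSpace A] [MetricSpace B]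
    (S : A → B → ℝ → Prop) (hne : ∃ a b e, S a b e)
    (hS : ∀ a b e a' b' e', S a b e → S a' b' e' → dist b b' ≤ dist a a' + e + e')
    (F : B → ℝ) (hF : ∀ b b', F b - F b' ≤ dist b b') :
    ∃ G : A → ℝ, (∀ a a', G a - G a' ≤ dist a a') ∧ ∀ a b e, S a b e → |G a - F b| ≤ e := by
  obtain ⟨a₀, b₀, e₀, h₀⟩ := hne
  let T := {q : A × B × ℝ // S q.1 q.2.1 q.2.2}
  have : Nonempty T := ⟨⟨(a₀, b₀, e₀), h₀⟩⟩
  let g : A → T → ℝ := fun a q => dist a q.1.1 + q.1.2.2 + F q.1.2.1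
  have hb : ∀ a, BddBelow (Set.range (g a)) := by
    intro a
    refine ⟨F b₀ - e₀ - dist a₀ a, ?_⟩
    rintro _ ⟨⟨⟨a', b', e'⟩, h'⟩, rfl⟩
    have h1 := hS _ _ _ _ _ _ h₀ h'
    have h2 := hF b₀ b'
    have h3 := dist_triangle a₀ a a'
    simp only [g]
    linarith
  refine ⟨fun a => ⨅ q, g a q, ?_, ?_⟩
  · intro a a'
    have : (⨅ q, g a q) - dist a a' ≤ ⨅ q, g a' q := by
      refine le_ciInf fun q => ?_
      have h1 := ciInf_le (hb a) q
      have h2 := dist_triangle a a' q.1.1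
      simp only [g] at h1 ⊢
      linarith
    linarith
  · intro a b e h
    rw [abs_le]
    constructor
    · have : F b - e ≤ ⨅ q, g a q := by
        refine le_ciInf fun q => ?_
        have h1 := hS _ _ _ _ _ _ h q.2
        have h2 := hF b q.1.2.1
        simp only [g]
        linarith
      linarith
    · have h1 := ciInf_le (hb a) ⟨(a, b, e), h⟩
      simp only [g, dist_self] at h1
      linarith

/-- Pointed Gromov-Hausdorff convergence can always be realized inside a Banach space. -/
theorem PointedGHTendsto.exists_ghEmbedding [Preorder I] {y : ∀ i, Y i} {y₀ : Y₀}
    (h : PointedGHTendsto y y₀) :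
    ∃ (𝔹 : Type (max uI uY uY₀)) (_ : NormedAddCommGroup 𝔹) (_ : NormedSpace ℝ 𝔹)
      (_ : CompleteSpace 𝔹) (α : ∀ i, Y i → 𝔹) (α₀ : Y₀ → 𝔹), IsGHEmbedding y y₀ α α₀ := by
  classical
  obtain ⟨ψ, hψ0, hψ⟩ := h
  let V : I → ℝ → ℝ → Prop := fun i r ε => 0 < r ∧ 0 < ε ∧
    ∀ x ∈ Metric.ball (y i) r, ∀ x' ∈ Metric.ball (y i) r,
        |dist (ψ i x) (ψ i x') - dist x x'| < ε
  let B : ∀ i, Y i → Y₀ → ℝ → Prop := fun i x w ε => w = ψ i x ∧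
    ((x = y i ∧ ε = 1) ∨ ∃ r, V i r ε ∧ x ∈ Metric.ball (y i) r)
  have hB1 : ∀ i, B i (y i) y₀ 1 := fun i => ⟨(hψ0 i).symm, Or.inl ⟨rfl, rfl⟩⟩
  have hBc : ∀ i x w ε x' w' ε', B i x w ε → B i x' w' ε' →
      |dist w w' - dist x x'| ≤ ε + ε' := by
    rintro i x w ε x' w' ε' ⟨rfl, h⟩ ⟨rfl, h'⟩
    rcases h with ⟨rfl, rfl⟩ | ⟨r, ⟨hr, hε, hV⟩, hx⟩
    · rcases h' with ⟨rfl, rfl⟩ | ⟨r, ⟨hr, hε, hV⟩, hx⟩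
      · simp
      · have := hV _ (Metric.mem_ball_self hr) _ hx
        linarith
    · rcases h' with ⟨rfl, rfl⟩ | ⟨r', ⟨hr', hε', hV'⟩, hx'⟩
      · have := hV _ hx _ (Metric.mem_ball_self hr)
        linarith
      · rcases le_total r r' with hrr | hrr
        · have := hV' _ (Metric.ball_subset_ball hrr hx) _ hx'
          linarith
        · have := hV _ hx _ (Metric.ball_subset_ball hrr hx')
          linarith
  have hext : ∀ F : Y₀ → ℝ, (∀ z z', F z - F z' ≤ dist z z') → ∀ i, ∃ G : Y i → ℝ,
      (∀ a a', G a - G a' ≤ dist a a') ∧ ∀ a b e, B i a b e → |G a - F b| ≤ e := by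
    intro F hF i
    refine exists_lipschitz_transfer (B i) ⟨_, _, _, hB1 i⟩ ?_ F hF
    intro a b e a' b' e' h1 h2
    have := (abs_le.1 (hBc _ _ _ _ _ _ _ h1 h2)).2
    linarith
  have hext' : ∀ i, ∀ F : Y i → ℝ, (∀ z z', F z - F z' ≤ dist z z') → ∃ G : Y₀ → ℝ,
      (∀ a a', G a - G a' ≤ dist a a') ∧ ∀ a b e, B i a b e → |F a - G b| ≤ e := by
    intro i F hF
    obtain ⟨G, hG, hG'⟩ := exists_lipschitz_transfer (fun w x e => B i x w e)
      ⟨_, _, _, hB1 i⟩ (by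
        intro a b e a' b' e' h1 h2
        have := (abs_le.1 (hBc _ _ _ _ _ _ _ h1 h2)).1
        linarith) F hF
    exact ⟨G, hG, fun a b e hab => by rw [abs_sub_comm]; exact hG' _ _ _ hab⟩
  let T := BridgedFamily B
  have hT0 : ∀ t : T, ∀ z z', |t.1.1 z - t.1.1 z'| ≤ dist z z' := fun t z z' =>
    abs_le.2 ⟨by have := t.2.1 z' z; rw [dist_comm] at this; linarith, t.2.1 z z'⟩
  have hTi : ∀ t : T, ∀ i x x', |t.1.2 i x - t.1.2 i x'| ≤ dist x x' := fun t i z z' =>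
    abs_le.2 ⟨by have := t.2.2.1 i z' z; rw [dist_comm] at this; linarith, t.2.2.1 i z z'⟩
  have ex0 : ∀ F : Y₀ → ℝ, (∀ z z', F z - F z' ≤ dist z z') → ∃ t : T, t.1.1 = F := by
    intro F hF
    choose G hG hG' using hext F hF
    exact ⟨⟨(F, G), hF, hG, hG'⟩, rfl⟩
  have exi : ∀ i, ∀ F : Y i → ℝ, (∀ z z', F z - F z' ≤ dist z z') → ∃ t : T, t.1.2 i = F := by
    intro i F hF
    obtain ⟨F₀, hF₀, hF₀'⟩ := hext' i F hF
    choose G hG hG' using hext F₀ hF₀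
    refine ⟨⟨(F₀, Function.update G i F), hF₀, ?_, ?_⟩, by simp⟩
    · intro j
      by_cases hj : j = i
      · subst hj; simpa using hF
      · simpa [Function.update_of_ne hj] using hG j
    · intro j
      by_cases hj : j = i
      · subst hj; simpa using hF₀'
      · simpa [Function.update_of_ne hj] using hG' j
  have m0 : ∀ z, Memℓp (fun t : T => t.1.1 z - t.1.1 y₀) ∞ := fun z =>
    memℓp_infty ⟨dist z y₀, by rintro _ ⟨t, rfl⟩; exact hT0 t z y₀⟩
  have mi : ∀ i x, Memℓp (fun t : T => t.1.2 i x - t.1.1 y₀) ∞ := fun i x =>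
    memℓp_infty ⟨dist x (y i) + 1, by
      rintro _ ⟨t, rfl⟩
      have h1 := hTi t i x (y i)
      have h2 := t.2.2.2 i _ _ _ (hB1 i)
      have := abs_sub_le (t.1.2 i x) (t.1.2 i (y i)) (t.1.1 y₀)
      simp only [Real.norm_eq_abs]
      linarith⟩
  let α : ∀ i, Y i → lp (fun _ : T => ℝ) ∞ := fun i x => ⟨_, mi i x⟩
  let α₀ : Y₀ → lp (fun _ : T => ℝ) ∞ := fun z => ⟨_, m0 z⟩
  have iso0 : Isometry α₀ := by
    refine Isometry.of_dist_eq fun z z' => le_antisymm ?_ ?_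
    · rw [dist_eq_norm]
      refine lp.norm_le_of_forall_le dist_nonneg fun t => ?_
      change |(t.1.1 z - t.1.1 y₀) - (t.1.1 z' - t.1.1 y₀)| ≤ _
      rw [sub_sub_sub_cancel_right]
      exact hT0 t z z'
    · obtain ⟨t, ht⟩ := ex0 (fun w => dist w z') (fun w w' => by
        have := dist_triangle w w' z'; linarith)
      have := lp.norm_apply_le_norm ENNReal.top_ne_zero (α₀ z - α₀ z') t
      change |(t.1.1 z - t.1.1 y₀) - (t.1.1 z' - t.1.1 y₀)| ≤ _ at this
      rw [sub_sub_sub_cancel_right, ht] at this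
      beta_reduce at this
      rw [dist_self, sub_zero, abs_of_nonneg dist_nonneg] at this
      rwa [dist_eq_norm (α₀ z)]
  have isoi : ∀ i, Isometry (α i) := by
    intro i
    refine Isometry.of_dist_eq fun z z' => le_antisymm ?_ ?_
    · rw [dist_eq_norm]
      refine lp.norm_le_of_forall_le dist_nonneg fun t => ?_
      change |(t.1.2 i z - t.1.1 y₀) - (t.1.2 i z' - t.1.1 y₀)| ≤ _
      rw [sub_sub_sub_cancel_right]
      exact hTi t i z z'
    · obtain ⟨t, ht⟩ := exi i (fun w => dist w z') (fun w w' => by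
        have := dist_triangle w w' z'; linarith)
      have := lp.norm_apply_le_norm ENNReal.top_ne_zero (α i z - α i z') t
      change |(t.1.2 i z - t.1.1 y₀) - (t.1.2 i z' - t.1.1 y₀)| ≤ _ at this
      rw [sub_sub_sub_cancel_right, ht] at this
      beta_reduce at this
      rw [dist_self, sub_zero, abs_of_nonneg dist_nonneg] at this
      rwa [dist_eq_norm (α i z)]
  have near : ∀ i x r ε, V i r ε → x ∈ Metric.ball (y i) r →
      dist (α i x) (α₀ (ψ i x)) ≤ ε := by
    intro i x r ε hV hx
    rw [dist_eq_norm]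
    refine lp.norm_le_of_forall_le hV.2.1.le fun t => ?_
    change |(t.1.2 i x - t.1.1 y₀) - (t.1.1 (ψ i x) - t.1.1 y₀)| ≤ _
    rw [sub_sub_sub_cancel_right]
    exact t.2.2.2 i _ _ _ ⟨rfl, Or.inr ⟨r, hV, hx⟩⟩
  have hbase : Tendsto (fun i => α i (y i)) atTop (𝓝 (α₀ y₀)) := by
    rw [Metric.tendsto_nhds]
    intro ε hε
    filter_upwards [hψ 1 one_pos (ε / 2) (by linarith)] with i hi
    have := near i (y i) 1 (ε / 2) ⟨one_pos, by linarith, hi.1⟩ (Metric.mem_ball_self one_pos)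
    rw [hψ0] at this
    linarith
  refine ⟨lp (fun _ : T => ℝ) ∞, inferInstance, inferInstance, inferInstance, α, α₀,
    isoi, iso0, hbase, ?_⟩
  intro o r ε hr hε
  set Q : ℝ := r + dist o (α₀ y₀) + 1 with hQ
  have hQ0 : 0 < Q := by have := dist_nonneg (x := o) (y := α₀ y₀); linarith
  set η : ℝ := min 1 (ε / 3) with hη
  have hη0 : 0 < η := lt_min one_pos (by linarith)
  have hη1 : η ≤ 1 := min_le_left _ _
  have hη2 : η ≤ ε / 3 := min_le_right _ _
  filter_upwards [hψ Q hQ0 η hη0, hψ (Q + 1) (by linarith) η hη0,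
    (Metric.tendsto_nhds.1 hbase) 1 one_pos] with i h1 h2 h3
  constructor
  · rintro _ ⟨⟨x, rfl⟩, hx⟩
    have hx' : x ∈ Metric.ball (y i) Q := by
      rw [Metric.mem_ball] at hx ⊢
      rw [← (isoi i).dist_eq]
      have e1 := dist_triangle (α i x) o (α i (y i))
      have e2 := dist_triangle o (α₀ y₀) (α i (y i))
      rw [dist_comm (α₀ y₀)] at e2
      linarith
    refine Metric.mem_thickening_iff.2 ⟨_, ⟨ψ i x, rfl⟩, ?_⟩
    have := near i x Q η ⟨hQ0, hη0, h1.1⟩ hx'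
    linarith
  · rintro _ ⟨⟨z, rfl⟩, hz⟩
    have hz' : z ∈ Metric.ball y₀ Q := by
      rw [Metric.mem_ball] at hz ⊢
      rw [← iso0.dist_eq]
      have e1 := dist_triangle (α₀ z) o (α₀ y₀)
      linarith
    obtain ⟨x, hx, hxz⟩ := h1.2 z hz'
    refine Metric.mem_thickening_iff.2 ⟨_, ⟨x, rfl⟩, ?_⟩
    have hx2 : x ∈ Metric.ball (y i) (Q + 1) := Metric.ball_subset_ball (by linarith) hx
    have e1 := near i x (Q + 1) η ⟨by linarith, hη0, h2.1⟩ hx2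
    have e2 := dist_triangle (α₀ z) (α₀ (ψ i x)) (α i x)
    rw [iso0.dist_eq, dist_comm (α₀ (ψ i x))] at e2
    linarith

end Existence

end

/-! Fix an ultrafilter `U` finer than `atTop`, along which the energies are at most `A` and the maps
`u i` are bounded in `L^p`. At a scale `r`, take a finite `r`-separated covering set `D` in `M₀` and
lift it to `M i`. On the ball around each lifted point the Poincaré inequality makes `u i` close to
one of its own values. The errors add up to about `C r^p K A`, where `K ≤ f r` bounds the overlap of
the enlarged balls, and `f r = o(r^(-p))` makes this small. A partition of unity on `M₀`, pulled
back by `φ i`, glues the values to an approximation of `u i` in `L^p` (`eventually_exists_values`).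
The values are bounded because preimages of balls have measure bounded below. Since `Y₀` is proper,
these finitely many values converge in `𝔹` along `U`, so `u i` is close to `g ∘ φ i` for a single
continuous `g` (`exists_continuous_approx`). As the error tends to zero, the maps `g` form a Cauchy
sequence in `L^p(M₀, 𝔹)`, because weak convergence carries `L^p`-norms of continuous maps to the
limit (`exists_strong_limit`). The limit takes values in `Y₀` because a truncated distance to `Y₀`
is Lipschitz and is small on `Y i` (`ae_mem_range_of_strong_limit`). A net generating `U` is the
required subnet. -/

noncomputable section

/-! ### Nets generating a filter -/

/-- A nontrivial filter on `I` is generated by a net `J → I` whose index set lives in the universe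
of `I`. -/
theorem exists_net_tendsto_filter {I : Type uI} (F : Filter I) [F.NeBot] :
    ∃ (J : Type uI) (_ : Preorder J) (_ : IsDirectedOrder J) (_ : Nonempty J) (h : J → I),
      Tendsto h atTop F := by
  -- The order sees only the set, reversed by inclusion, so this is a preorder; the point is the
  -- value of the net.
  let J := {s : Set I × I // s.1 ∈ F ∧ s.2 ∈ s.1}
  let P : Preorder J :=
    { le := fun a b => b.1.1 ⊆ a.1.1
      le_refl := fun a => subset_rfl
      le_trans := fun a b c hab hbc => hbc.trans hab }
  have ex : ∀ S ∈ F, ∃ j : J, j.1.1 = S := fun S hS => by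
    obtain ⟨i, hi⟩ := F.nonempty_of_mem hS
    exact ⟨⟨(S, i), hS, hi⟩, rfl⟩
  have hD : IsDirectedOrder J := ⟨fun a b => by
    obtain ⟨j, hj⟩ := ex _ (inter_mem a.2.1 b.2.1)
    exact ⟨j, show j.1.1 ⊆ a.1.1 from hj ▸ Set.inter_subset_left,
      show j.1.1 ⊆ b.1.1 from hj ▸ Set.inter_subset_right⟩⟩
  have hN : Nonempty J := let ⟨j, _⟩ := ex _ univ_mem; ⟨j⟩
  refine ⟨J, P, hD, hN, fun j => j.1.2, fun S hS => ?_⟩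
  obtain ⟨j, hj⟩ := ex S hS
  refine mem_map.2 (mem_of_superset (mem_atTop j) fun k (hk : k.1.1 ⊆ j.1.1) => ?_)
  exact hj ▸ hk k.2.2

/-! ### Finitely additive contents and bounded overlap -/

theorem IsFinitelyAdditive.empty {M : Type uM} [MeasurableSpace M] {ν : Set M → ℝ≥0}
    (hν : IsFinitelyAdditive ν) : ν ∅ = 0 := by
  have := hν ∅ ∅ .empty .empty (by simp)
  simpa using this

theorem IsFinitelyAdditive.preimage_finset {M : Type uM} [MeasurableSpace M] {ν : Set M → ℝ≥0}
    (hν : IsFinitelyAdditive ν) {P : Type*} (t : M → P)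
    (ht : ∀ q, MeasurableSet (t ⁻¹' {q})) (S : Finset P) :
    ν (t ⁻¹' (S : Set P)) = ∑ q ∈ S, ν (t ⁻¹' {q}) := by
  classical
  induction S using Finset.induction_on with
  | empty => simp [hν.empty]
  | insert a S ha ih =>
    rw [Finset.sum_insert ha, ← ih, ← hν _ _ (ht a)]
    · rw [Finset.coe_insert, Set.insert_eq, Set.preimage_union]
    · have : t ⁻¹' (S : Set P) = ⋃ q ∈ S, t ⁻¹' {q} := by ext; simp
      rw [this]
      exact Finset.measurableSet_biUnion _ fun q _ => ht q
    · rw [Set.disjoint_left]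
      rintro x hx hx'
      simp only [Set.mem_preimage, Set.mem_singleton_iff] at hx
      simp only [Set.mem_preimage, hx, Finset.mem_coe] at hx'
      exact ha hx'

/-- If every point lies in at most `K` of the sets `A z`, then the contents of the `A z` sum up to
at most `K` times the total content. -/
theorem IsFinitelyAdditive.sum_le_of_overlap {M : Type uM} [MeasurableSpace M] {ν : Set M → ℝ≥0}
    (hν : IsFinitelyAdditive ν) {ι : Type*} (D : Finset ι) (A : ι → Set M)
    (hA : ∀ z ∈ D, MeasurableSet (A z)) (K : ℝ≥0∞)
    (hK : ∀ x, ({z | z ∈ D ∧ x ∈ A z}.encard : ℝ≥0∞) ≤ K) :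
    ∑ z ∈ D, (ν (A z) : ℝ≥0∞) ≤ K * ν Set.univ := by
  classical
  -- A content need not integrate the counting function, so `M` is cut into the finitely many atoms
  -- on which the set of indices `z` with `x ∈ A z` is constant.
  let t : M → Finset ι := fun x => D.filter fun z => x ∈ A z
  have htm : ∀ q, MeasurableSet (t ⁻¹' {q}) := by
    intro q
    by_cases hq : q ⊆ D
    · have : t ⁻¹' {q} = ⋂ z ∈ D, {x | x ∈ A z ↔ z ∈ q} := by
        ext x
        simp only [Set.mem_preimage, Set.mem_singleton_iff, Set.mem_iInter, Set.mem_ofPred_eq, t]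
        constructor
        · rintro rfl z hz; simp [hz]
        · intro h; ext z
          simp only [Finset.mem_filter]
          exact ⟨fun hz => (h z hz.1).1 hz.2, fun hz => ⟨hq hz, (h z (hq hz)).2 hz⟩⟩
      rw [this]
      refine Finset.measurableSet_biInter _ fun z hz => ?_
      by_cases hzq : z ∈ q
      · simpa [hzq] using hA z hz
      · simp only [hzq, iff_false]
        exact (hA z hz).compl
    · have : t ⁻¹' {q} = ∅ := by
        ext x
        simp only [Set.mem_preimage, Set.mem_singleton_iff, Set.mem_empty_iff_false, iff_false, t]
        rintro rfl
        exact hq (Finset.filter_subset _ _)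
      rw [this]; exact .empty
  have hu : ν Set.univ = ∑ q ∈ D.powerset, ν (t ⁻¹' {q}) := by
    rw [← hν.preimage_finset t htm]
    congr 1
    ext x
    simp only [Set.mem_univ, Set.mem_preimage, Finset.mem_coe, Finset.mem_powerset, true_iff]
    exact Finset.filter_subset _ _
  have hz : ∀ z ∈ D, ν (A z) = ∑ q ∈ D.powerset, if z ∈ q then ν (t ⁻¹' {q}) else 0 := by
    intro z hz
    rw [← Finset.sum_filter, ← hν.preimage_finset t htm]
    congr 1
    ext x
    simp [t, hz]
  calc ∑ z ∈ D, (ν (A z) : ℝ≥0∞)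
      = ∑ q ∈ D.powerset, ∑ z ∈ D, if z ∈ q then (ν (t ⁻¹' {q}) : ℝ≥0∞) else 0 := by
        rw [Finset.sum_comm]
        refine Finset.sum_congr rfl fun z hzD => ?_
        rw [hz z hzD]
        push_cast
        refine Finset.sum_congr rfl fun q _ => ?_
        split_ifs <;> simp
    _ ≤ ∑ q ∈ D.powerset, K * (ν (t ⁻¹' {q}) : ℝ≥0∞) := by
        refine Finset.sum_le_sum fun q hq => ?_
        rcases (t ⁻¹' {q}).eq_empty_or_nonempty with h | ⟨x, hx⟩
        · simp [h, hν.empty]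
        · rw [← Finset.sum_filter, Finset.sum_const, nsmul_eq_mul]
          gcongr
          refine le_trans ?_ (hK x)
          have : {z | z ∈ D ∧ x ∈ A z} = ((D.filter fun z => z ∈ q : Finset ι) : Set ι) := by
            ext z
            have hx' : t x = q := hx
            rw [← hx']
            simp [t]
          rw [this, Set.encard_coe_eq_coe_finsetCard]
          simp
    _ = K * ν Set.univ := by rw [← Finset.mul_sum, hu]; push_cast; rfl

/-! ### Separated sets, mean values and partitions of unity -/

/-- A compact metric space contains a finite `r`-separated set that is `r'`-dense for some
`r' < r`. -/
theorem exists_finite_separated_cover (S : Type uM) [MetricSpace S] [CompactSpace S] {r : ℝ}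
    (hr : 0 < r) : ∃ D : Finset S, ((D : Set S).Pairwise fun a b => r ≤ dist a b) ∧
      ∃ r' ∈ Set.Ioo 0 r, ∀ x, ∃ z ∈ D, dist x z < r' := by
  obtain ⟨D, hD⟩ := zorn_subset {D : Set S | D.Pairwise fun a b => r ≤ dist a b} (by
    intro c hc hch
    refine ⟨⋃₀ c, ?_, fun s hs => Set.subset_sUnion_of_mem hs⟩
    exact (Set.pairwise_sUnion hch.directedOn).2 fun s hs => hc hs)
  have hfin : D.Finite := by
    obtain ⟨t, -, ht, hcov⟩ := (isCompact_univ (X := S)).finite_cover_balls (half_pos hr)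
    choose g hg using fun x => Set.mem_iUnion₂.1 (hcov (Set.mem_univ x))
    refine Set.Finite.of_finite_image (f := g) (ht.subset ?_) ?_
    · rintro _ ⟨x, -, rfl⟩; exact (hg x).1
    · intro a ha b hb hab
      by_contra hne
      have h1 := hD.prop ha hb hne
      have h2 := (hg a).2
      have h3 := (hg b).2
      change g a = g b at hab
      rw [← hab] at h3
      rw [Metric.mem_ball] at h2 h3
      have := dist_triangle_right a b (g a)
      linarith
  have hcov : ∀ x, ∃ z ∈ D, dist x z < r := by
    intro x
    by_contra! h
    have hx : x ∈ D := by
      refine hD.le_of_ge (y := insert x D) ?_ (Set.subset_insert x D) (Set.mem_insert x D)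
      refine (Set.pairwise_insert).2 ⟨hD.prop, fun b hb _ => ⟨h b hb, ?_⟩⟩
      rw [dist_comm]; exact h b hb
    have := h x hx
    simp at this
    linarith
  refine ⟨hfin.toFinset, by simpa using hD.prop, ?_⟩
  rcases isEmpty_or_nonempty S with hS | hS
  · exact ⟨r / 2, ⟨half_pos hr, half_lt_self hr⟩, fun x => hS.elim x⟩
  -- Maximality gives covering radius `r`. The distance to `D` attains its maximum, so the radius
  -- can be lowered strictly; the gap later absorbs the distortion of `φ i`.
  obtain ⟨m, -, hm⟩ := isCompact_univ.exists_isMaxOn Set.univ_nonempty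
    (Metric.continuous_infDist_pt D).continuousOn
  have hm' : Metric.infDist m D < r := by
    obtain ⟨z, hz, hzm⟩ := hcov m
    exact (Metric.infDist_le_dist_of_mem hz).trans_lt hzm
  obtain ⟨r', h1, h2⟩ := exists_between hm'
  refine ⟨r', ⟨Metric.infDist_nonneg.trans_lt h1, h2⟩, fun x => ?_⟩
  have hne : D.Nonempty := let ⟨z, hz, _⟩ := hcov m; ⟨z, hz⟩
  obtain ⟨z, hz, hxz⟩ := (Metric.infDist_lt_iff hne).1 ((hm (Set.mem_univ x)).trans_lt h1)
  exact ⟨z, by simpa using hz, hxz⟩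

/-- Some point of `B` does not exceed the mean value over `B` by more than `η`. -/
theorem exists_le_of_inv_mul_setLIntegral_le {M : Type uM} [MeasurableSpace M] {μ : Measure M}
    [IsFiniteMeasure μ] {B : Set M} (hB : MeasurableSet B) (h0 : μ B ≠ 0) (F : M → ℝ≥0∞)
    {T η : ℝ≥0∞} (hT : T ≠ ∞) (hη : η ≠ 0) (h : (μ B)⁻¹ * ∫⁻ a in B, F a ∂μ ≤ T) :
    ∃ b ∈ B, F b ≤ T + η := by
  by_contra! hcon
  have h1 : (T + η) * μ B ≤ ∫⁻ a in B, F a ∂μ := by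
    rw [← setLIntegral_const]
    exact setLIntegral_mono' hB fun x hx => (hcon x hx).le
  -- The slack `η` produces the contradiction; comparing integrals alone would only give `T ≤ T`.
  have h2 : T + η ≤ T := by
    refine le_trans ?_ h
    rw [← ENNReal.div_eq_inv_mul]
    exact (ENNReal.le_div_iff_mul_le (.inl h0) (.inl (measure_ne_top _ _))).2 h1
  exact (ENNReal.lt_add_right hT hη).not_ge h2

theorem lpDist_eq_eLpNorm {M : Type uM} [MeasurableSpace M] {𝔹 : Type uB} [NormedAddCommGroup 𝔹]
    {p : ℝ} (hp : 0 < p) (μ : Measure M) (u v : M → 𝔹) :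
    lpDist p μ u v = eLpNorm (fun x => u x - v x) (ENNReal.ofReal p) μ := by
  rw [eLpNorm_eq_lintegral_rpow_enorm_toReal (by simpa using hp) ENNReal.ofReal_ne_top,
    ENNReal.toReal_ofReal hp.le, lpDist]
  simp only [edist_eq_enorm_sub]

theorem exists_partition_of_unity_balls {S : Type uM} [MetricSpace S] (D : Finset S) {r : ℝ}
    (hD : ∀ x, ∃ z ∈ D, dist x z < r) :
    ∃ l : S → S → ℝ, (∀ z, Continuous (l z)) ∧ (∀ z x, 0 ≤ l z x) ∧ (∀ x, ∑ z ∈ D, l z x = 1) ∧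
      ∀ z x, r ≤ dist x z → l z x = 0 := by
  let b : S → S → ℝ := fun z x => max 0 (r - dist x z)
  have hb : ∀ z, Continuous (b z) := fun z => by fun_prop
  have hb0 : ∀ z x, 0 ≤ b z x := fun z x => le_max_left _ _
  have hpos : ∀ x, 0 < ∑ z ∈ D, b z x := by
    intro x
    obtain ⟨z, hz, hxz⟩ := hD x
    exact Finset.sum_pos' (fun z _ => hb0 z x) ⟨z, hz, lt_max_of_lt_right (by linarith)⟩
  refine ⟨fun z x => b z x / ∑ z' ∈ D, b z' x, fun z => ?_, fun z x => ?_, fun x => ?_,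
    fun z x h => ?_⟩
  · exact (hb z).div (continuous_finsetSum _ fun z _ => hb z) fun x => (hpos x).ne'
  · exact div_nonneg (hb0 z x) (hpos x).le
  · rw [← Finset.sum_div, div_self (hpos x).ne']
  · have : b z x = 0 := max_eq_left (by linarith)
    simp [this]

/-- Jensen's inequality for the distance to a convex combination. -/
theorem enorm_sub_sum_smul_rpow_le {𝔹 : Type uB} [NormedAddCommGroup 𝔹] [NormedSpace ℝ 𝔹]
    {ι : Type*} (D : Finset ι) {l : ι → ℝ} (hl : ∀ z ∈ D, 0 ≤ l z) (hl1 : ∑ z ∈ D, l z = 1)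
    (v : 𝔹) (W : ι → 𝔹) {p : ℝ} (hp : 1 ≤ p) :
    ‖v - ∑ z ∈ D, l z • W z‖ₑ ^ p ≤ ∑ z ∈ D, ENNReal.ofReal (l z) * ‖v - W z‖ₑ ^ p := by
  have h1 : v - ∑ z ∈ D, l z • W z = ∑ z ∈ D, l z • (v - W z) := by
    simp only [smul_sub, Finset.sum_sub_distrib, ← Finset.sum_smul, hl1, one_smul]
  have h2 : ‖v - ∑ z ∈ D, l z • W z‖ₑ ≤ ∑ z ∈ D, ENNReal.ofReal (l z) * ‖v - W z‖ₑ := by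
    rw [h1]
    refine (enorm_sum_le _ _).trans (Finset.sum_le_sum fun z hz => ?_)
    rw [enorm_smul, Real.enorm_of_nonneg (hl z hz)]
  refine (ENNReal.rpow_le_rpow h2 (by linarith)).trans ?_
  refine ENNReal.rpow_arith_mean_le_arith_mean_rpow _ _ _ ?_ hp
  rw [← ENNReal.ofReal_sum_of_nonneg hl, hl1, ENNReal.ofReal_one]

/-- Jensen's inequality is integrated: each weight is at most 1 and vanishes off its set, so it is
dominated by the indicator of that set. -/
theorem lintegral_enorm_sub_sum_smul_le {M : Type uM} [MeasurableSpace M] {μ : Measure M}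
    {𝔹 : Type uB} [NormedAddCommGroup 𝔹] [NormedSpace ℝ 𝔹] {ι : Type*} (D : Finset ι)
    {l : ι → M → ℝ} (hl : ∀ z a, 0 ≤ l z a) (hl1 : ∀ a, ∑ z ∈ D, l z a = 1)
    {B : ι → Set M} (hB : ∀ z, MeasurableSet (B z)) (hlB : ∀ z ∈ D, ∀ a, a ∉ B z → l z a = 0)
    {u : M → 𝔹} (hu : AEStronglyMeasurable u μ) (W : ι → 𝔹) {p : ℝ} (hp : 1 ≤ p) :
    ∫⁻ a, ‖u a - ∑ z ∈ D, l z a • W z‖ₑ ^ p ∂μ ≤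
      ∑ z ∈ D, ∫⁻ a in B z, ‖u a - W z‖ₑ ^ p ∂μ := by
  have hm : ∀ z, AEMeasurable (fun a => ‖u a - W z‖ₑ ^ p) μ := fun z =>
    (hu.sub aestronglyMeasurable_const).enorm.pow_const p
  simp_rw [← lintegral_indicator (hB _)]
  rw [← lintegral_finsetSum' _ fun z _ => (hm z).indicator (hB z)]
  refine lintegral_mono fun a => ?_
  refine (enorm_sub_sum_smul_rpow_le D (fun z _ => hl z a) (hl1 a) _ _ hp).trans ?_
  refine Finset.sum_le_sum fun z hz => ?_
  by_cases ha : a ∈ B z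
  · rw [Set.indicator_of_mem ha]
    refine mul_le_of_le_one_left' ?_
    rw [← ENNReal.ofReal_one, ← hl1 a]
    exact ENNReal.ofReal_le_ofReal
      (Finset.single_le_sum (f := fun z => l z a) (fun z _ => hl z a) hz)
  · simp [ha, hlB z hz a ha]

/-! ### Compactness of values in the ambient Banach space -/

section Embedding

variable {I : Type uI} [Preorder I] {Y : I → Type uY} {Y₀ : Type uY₀}
  [∀ i, MetricSpace (Y i)] [MetricSpace Y₀] {𝔹 : Type uB} [NormedAddCommGroup 𝔹]
  {y : ∀ i, Y i} {y₀ : Y₀} {α : ∀ i, Y i → 𝔹} {α₀ : Y₀ → 𝔹}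

/-- Hausdorff convergence pushes the points towards a compact piece of `Y₀`; nearest points there
converge along the ultrafilter, and the original points follow. -/
theorem IsGHEmbedding.exists_tendsto_of_bounded [ProperSpace Y₀] (hα : IsGHEmbedding y y₀ α α₀)
    {U : Ultrafilter I} (hU : (U : Filter I) ≤ atTop) {w : I → 𝔹} {b : ℝ}
    (hw : ∀ᶠ i in U, w i ∈ Set.range (α i)) (hb : ∀ᶠ i in U, ‖w i‖ ≤ b) :
    ∃ v, Tendsto w U (𝓝 v) := by
  have hb0 : 0 ≤ b := let ⟨i, hi⟩ := hb.exists; (norm_nonneg _).trans hi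
  -- The radius adds the bound on `w i`, a distance below 1 to the approximating point, and the
  -- passage from the origin to `α₀ y₀`.
  let K : Set 𝔹 := α₀ '' Metric.closedBall y₀ (b + 1 + ‖α₀ y₀‖)
  have hK : IsCompact K := (isCompact_closedBall _ _).image hα.isometry₀.continuous
  have hKne : K.Nonempty :=
    ⟨α₀ y₀, y₀, Metric.mem_closedBall_self (by positivity), rfl⟩
  have hnear : ∀ ε > 0, ∀ᶠ i in U, Metric.infDist (w i) K < ε := by
    intro ε hε
    filter_upwards [hw, hb, hU (hα.hausdorff 0 (b + 1) (min ε 1) (by linarith) (by positivity))]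
      with i h1 h2 h3
    obtain ⟨_, ⟨z, rfl⟩, hz⟩ := Metric.mem_thickening_iff.1
      (h3.1 ⟨h1, by rw [mem_ball_zero_iff]; linarith⟩)
    have hzK : α₀ z ∈ K := Set.mem_image_of_mem _ ?_
    · exact (Metric.infDist_le_dist_of_mem hzK).trans_lt (hz.trans_le (min_le_left _ _))
    rw [Metric.mem_closedBall, ← hα.isometry₀.dist_eq]
    have e1 := dist_triangle (α₀ z) (w i) (α₀ y₀)
    have e2 := hz.trans_le (min_le_right _ _)
    have e3 := dist_le_norm_add_norm (w i) (α₀ y₀)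
    rw [dist_comm] at e2
    linarith
  choose k hkK hk using fun i => hK.exists_infDist_eq_dist hKne (w i)
  obtain ⟨v, -, hv⟩ := hK.ultrafilter_le_nhds (U.map k) (by
    rw [le_principal_iff, Ultrafilter.coe_map]
    exact mem_map.2 (Filter.univ_mem' hkK))
  refine ⟨v, (show Tendsto k U (𝓝 v) from hv).congr_dist ?_⟩
  rw [Metric.tendsto_nhds]
  intro ε hε
  filter_upwards [hnear ε hε] with i hi
  rw [Real.dist_0_eq_abs, abs_of_nonneg dist_nonneg, dist_comm, ← hk]
  exact hi

end Embedding

/-! ### Norms and measures of converging domains -/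

section Domains

variable {I : Type uI} [Preorder I] {M : I → Type uM} {M₀ : Type uM₀}
    [∀ i, MetricSpace (M i)] [∀ i, MeasurableSpace (M i)] [MetricSpace M₀] [CompactSpace M₀]
    [MeasurableSpace M₀] [BorelSpace M₀]
    {μ : ∀ i, Measure (M i)} [∀ i, IsFiniteMeasure (μ i)]
    {μ₀ : Measure M₀} [IsFiniteMeasure μ₀] {φ : ∀ i, M i → M₀}
    {𝔹 : Type uB} [NormedAddCommGroup 𝔹]

/-- The function `‖g‖ ^ p` is a continuous test function. All uses of weak convergence pass through
this lemma. -/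
theorem IsMeasuredGHApprox.tendsto_eLpNorm (hφ : IsMeasuredGHApprox μ μ₀ φ) {p : ℝ} (hp : 0 < p)
    (g : C(M₀, 𝔹)) :
    Tendsto (fun i => eLpNorm (fun x => g (φ i x)) (ENNReal.ofReal p) (μ i)) atTop
      (𝓝 (eLpNorm g (ENNReal.ofReal p) μ₀)) := by
  simp only [eLpNorm_eq_lintegral_rpow_enorm_toReal (p := ENNReal.ofReal p) (by simpa using hp)
    ENNReal.ofReal_ne_top, ENNReal.toReal_ofReal hp.le]
  let G : C(M₀, ℝ) := ⟨fun x => ‖g x‖ ^ p,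
    (g.continuous.norm).rpow_const fun _ => Or.inr hp.le⟩
  have hG0 : ∀ x, 0 ≤ G x := fun x => Real.rpow_nonneg (norm_nonneg _) _
  have key : ∀ x, ‖g x‖ₑ ^ p = ENNReal.ofReal (G x) := fun x => by
    rw [← ofReal_norm, ENNReal.ofReal_rpow_of_nonneg (norm_nonneg _) hp.le]
    rfl
  have h0 : ∫⁻ x, ‖g x‖ₑ ^ p ∂μ₀ = ENNReal.ofReal (∫ x, G x ∂μ₀) := by
    simp only [key]
    rw [ofReal_integral_eq_lintegral_ofReal _ (ae_of_all _ hG0)]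
    exact G.continuous.integrable_of_hasCompactSupport (HasCompactSupport.of_compactSpace _)
  have hi : ∀ i, ∫⁻ x, ‖g (φ i x)‖ₑ ^ p ∂(μ i) = ENNReal.ofReal (∫ x, G (φ i x) ∂(μ i)) := by
    intro i
    simp only [key]
    rw [ofReal_integral_eq_lintegral_ofReal _ (ae_of_all _ fun x => hG0 _)]
    refine Integrable.of_bound (C := ‖G‖)
      ((G.continuous.measurable.comp (hφ.measurable i)).aestronglyMeasurable)
      (ae_of_all _ fun x => G.norm_coe_le_norm _)
  simp only [h0, hi]
  exact (ENNReal.continuous_rpow_const.tendsto _).comp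
    ((ENNReal.continuous_ofReal.tendsto _).comp (hφ.weak G))

theorem IsMeasuredGHApprox.tendsto_measure_univ (hφ : IsMeasuredGHApprox μ μ₀ φ) :
    Tendsto (fun i => μ i Set.univ) atTop (𝓝 (μ₀ Set.univ)) := by
  have := hφ.tendsto_eLpNorm one_pos (ContinuousMap.const M₀ (1 : ℝ))
  simpa [eLpNorm_one_eq_lintegral_enorm] using this

/-- The preimages of a ball have measure bounded away from zero. -/
theorem IsMeasuredGHApprox.eventually_lt_measure_preimage [μ₀.IsOpenPosMeasure]
    (hφ : IsMeasuredGHApprox μ μ₀ φ) (z : M₀) {r : ℝ} (hr : 0 < r) :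
    ∃ m : ℝ≥0∞, 0 < m ∧ ∀ᶠ i in atTop, m < μ i (φ i ⁻¹' Metric.ball z r) := by
  -- This tent lies below the indicator of the ball and is positive at `z`, so full support makes
  -- its integral positive.
  let g : C(M₀, ℝ) := ⟨fun x => min 1 (max 0 (r - dist x z)), by fun_prop⟩
  have h := hφ.tendsto_eLpNorm one_pos g
  have hpos : 0 < eLpNorm g (ENNReal.ofReal 1) μ₀ := by
    rw [pos_iff_ne_zero, Ne, eLpNorm_eq_zero_iff g.continuous.aestronglyMeasurable (by simp)]
    intro h0
    have hg0 : (g : M₀ → ℝ) = 0 :=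
      (Continuous.ae_eq_iff_eq μ₀ g.continuous continuous_const).1 h0
    have : min 1 (max 0 (r - dist z z)) = 0 := congrFun hg0 z
    rw [dist_self, sub_zero, max_eq_right hr.le] at this
    exact (lt_min one_pos hr).ne' this
  obtain ⟨m, hm0, hm⟩ := exists_between hpos
  refine ⟨m, hm0, ?_⟩
  filter_upwards [h.eventually_const_lt hm] with i hi
  refine hi.trans_le ?_
  rw [ENNReal.ofReal_one, eLpNorm_one_eq_lintegral_enorm,
    ← lintegral_indicator_one (hφ.measurable i Metric.isOpen_ball.measurableSet)]
  refine lintegral_mono fun x => ?_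
  by_cases hx : x ∈ φ i ⁻¹' Metric.ball z r
  · rw [Set.indicator_of_mem hx]
    have : 0 ≤ g (φ i x) := le_min zero_le_one (le_max_left _ _)
    rw [Real.enorm_of_nonneg this, Pi.one_apply, ENNReal.ofReal_le_one]
    exact min_le_left _ _
  · have : g (φ i x) = 0 := by
      have : r ≤ dist (φ i x) z := not_lt.1 hx
      have h2 : max 0 (r - dist (φ i x) z) = 0 := max_eq_left (by linarith)
      change min 1 (max 0 (r - dist (φ i x) z)) = 0
      rw [h2]; simp
    rw [this]; simp

end Domains

/-! ### Consequences of the Poincaré inequality on one domain -/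

section Single

variable {M : Type uM} {Y : Type uY} [MeasurableSpace M] [MetricSpace Y]
  {𝔹 : Type uB} [NormedAddCommGroup 𝔹] {p : ℝ} {μ : Measure M} {y : Y} {a : Y → 𝔹}

theorem LpMap.coeFn_embed (ha : Isometry a) (u : LpMap p μ y) :
    ∀ᵐ x ∂μ, (u.embed a ha).1 x = a (u.1 x) - a y :=
  AEEqFun.coeFn_comp (fun z => a z - a y) (ha.continuous.sub continuous_const) u.1

theorem LpMap.lpDist_embed (ha : Isometry a) (u v : LpMap p μ y) :
    lpDist p μ (u.embed a ha).1 (v.embed a ha).1 = lpDist p μ u.1 v.1 := by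
  unfold lpDist
  congr 1
  refine lintegral_congr_ae ?_
  filter_upwards [u.coeFn_embed ha, v.coeFn_embed ha] with x h1 h2
  rw [h1, h2, edist_sub_right, ha.edist_eq]

/-- If the Poincaré inequality holds on the balls `B(x z, s)`, then `u` is `L^p`-close to a constant
on each of these balls. -/
theorem LpMap.exists_values_near [MetricSpace M] [BorelSpace M] [IsFiniteMeasure μ]
    [μ.IsOpenPosMeasure] (ha : Isometry a) (u : LpMap p μ y) {ν : Set M → ℝ≥0}
    (hν : IsFinitelyAdditive ν) {c C s : ℝ} (hs : 0 < s)
    (hP : ∀ x : M, (μ (Metric.ball x s))⁻¹ *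
      (∫⁻ a in Metric.ball x s, ∫⁻ b in Metric.ball x s, edist (u.1 a) (u.1 b) ^ p ∂μ ∂μ) ≤
        ENNReal.ofReal (C * s ^ p) * (ν (Metric.ball x (c * s)) : ℝ≥0∞))
    {ι : Type*} (D : Finset ι) (x : ι → M) {K : ℝ≥0∞}
    (hK : ∀ b, ({z | z ∈ D ∧ b ∈ Metric.ball (x z) (c * s)}.encard : ℝ≥0∞) ≤ K)
    {η : ℝ≥0∞} (hη : η ≠ 0) :
    ∃ w : ι → Y, ∑ z ∈ D, ∫⁻ b in Metric.ball (x z) s, ‖(u.embed a ha).1 b - (a (w z) - a y)‖ₑ ^ p ∂μ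
      ≤ ENNReal.ofReal (C * s ^ p) * (K * ν Set.univ) + D.card * η := by
  -- The left side of `hP` is the mean over the first variable of an integral in the second. A point
  -- where this integral is not much above its mean supplies a value of `u` itself, so `w` stays in
  -- `Y`.
  have h : ∀ z, ∃ w : Y, ∫⁻ b in Metric.ball (x z) s, edist w (u.1 b) ^ p ∂μ ≤
      ENNReal.ofReal (C * s ^ p) * (ν (Metric.ball (x z) (c * s)) : ℝ≥0∞) + η := by
    intro z
    obtain ⟨b, -, hb⟩ := exists_le_of_inv_mul_setLIntegral_le measurableSet_ball
      ((Metric.isOpen_ball.measure_pos μ ⟨x z, Metric.mem_ball_self hs⟩).ne') _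
      (ENNReal.mul_ne_top ENNReal.ofReal_ne_top ENNReal.coe_ne_top) hη (hP (x z))
    exact ⟨u.1 b, hb⟩
  choose w hw using h
  refine ⟨w, ?_⟩
  have hc : ∀ z, ∫⁻ b in Metric.ball (x z) s, ‖(u.embed a ha).1 b - (a (w z) - a y)‖ₑ ^ p ∂μ =
      ∫⁻ b in Metric.ball (x z) s, edist (w z) (u.1 b) ^ p ∂μ := by
    intro z
    refine lintegral_congr_ae (ae_restrict_of_ae ?_)
    filter_upwards [u.coeFn_embed ha] with b hb
    rw [hb, sub_sub_sub_cancel_right, ← edist_eq_enorm_sub, ha.edist_eq, edist_comm]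
  calc _ ≤ ∑ z ∈ D,
        (ENNReal.ofReal (C * s ^ p) * (ν (Metric.ball (x z) (c * s)) : ℝ≥0∞) + η) :=
        Finset.sum_le_sum fun z _ => (hc z).le.trans (hw z)
    _ ≤ _ := by
        rw [Finset.sum_add_distrib, ← Finset.mul_sum, Finset.sum_const, nsmul_eq_mul]
        gcongr
        exact hν.sum_le_of_overlap D _ (fun z _ => measurableSet_ball) K hK

/-- A constant that is `L^p`-close to `u` on a set of measure at least `m` is bounded in terms of
`m` and the `L^p`-norm of `u`. -/
theorem enorm_le_of_setLIntegral_sub_le (hp : 1 ≤ p) {B : Set M} {u : M → 𝔹}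
    (hu : AEStronglyMeasurable u μ) {w : 𝔹} {S T m : ℝ≥0∞} (hm0 : m ≠ 0) (hm : m ≤ μ B)
    (hm' : m ≠ ∞)
    (hS : ∫⁻ b in B, ‖u b - w‖ₑ ^ p ∂μ ≤ S) (hT : ∫⁻ b, ‖u b‖ₑ ^ p ∂μ ≤ T) :
    ‖w‖ₑ ≤ (2 ^ (p - 1) * (S + T) / m) ^ (1 / p) := by
  have hp0 : 0 < p := by linarith
  rw [one_div, ENNReal.le_rpow_inv_iff hp0, ENNReal.le_div_iff_mul_le (.inl hm0) (.inl hm')]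
  calc ‖w‖ₑ ^ p * m ≤ ‖w‖ₑ ^ p * μ B := by gcongr
    _ = ∫⁻ _ in B, ‖w‖ₑ ^ p ∂μ := by rw [setLIntegral_const]
    _ ≤ ∫⁻ b in B, 2 ^ (p - 1) * (‖u b - w‖ₑ ^ p + ‖u b‖ₑ ^ p) ∂μ := by
        refine lintegral_mono fun b => ?_
        refine le_trans ?_ (ENNReal.rpow_add_le_mul_rpow_add_rpow _ _ hp)
        gcongr
        have h := enorm_sub_le (a := u b) (b := u b - w)
        rw [sub_sub_cancel, add_comm] at h
        exact h
    _ = 2 ^ (p - 1) * (∫⁻ b in B, ‖u b - w‖ₑ ^ p ∂μ + ∫⁻ b in B, ‖u b‖ₑ ^ p ∂μ) := by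
        rw [lintegral_const_mul', lintegral_add_left']
        · exact ((hu.restrict.sub aestronglyMeasurable_const).enorm.pow_const p)
        · finiteness
    _ ≤ _ := by
        gcongr
        exact (setLIntegral_le_lintegral _ _).trans hT

end Single

/-! ### Approximation by continuous maps at a small scale -/

/-- This is where the growth condition on `f` makes the total Poincaré error small. The `A + 1`
keeps the divisor positive when `A = 0`. -/
theorem exists_scale {f : ℝ → ℝ} {p C R A δ : ℝ}
    (hf : f =o[𝓝[>] 0] fun r : ℝ => r ^ (-p)) (hC : 0 < C) (hR : 0 < R) (hA : 0 ≤ A)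
    (hδ : 0 < δ) : ∃ r, 0 < r ∧ r ≤ R ∧ C * r ^ p * (|f r| * A) ≤ δ := by
  have h1 := hf.def (c := δ / (C * (A + 1))) (by positivity)
  have h2 : ∀ᶠ r : ℝ in 𝓝[>] 0, r ∈ Set.Ioc 0 R := Ioc_mem_nhdsGT hR
  obtain ⟨r, hr, hr0, hrR⟩ := (h1.and h2).exists
  refine ⟨r, hr0, hrR, ?_⟩
  have hpos : 0 < r ^ p := Real.rpow_pos_of_pos hr0 p
  rw [Real.norm_eq_abs, Real.norm_eq_abs, Real.rpow_neg hr0.le, abs_of_pos (inv_pos.2 hpos)] at hr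
  calc C * r ^ p * (|f r| * A)
      ≤ C * r ^ p * (δ / (C * (A + 1)) * (r ^ p)⁻¹ * (A + 1)) := by
        gcongr
        linarith
    _ = δ := by field_simp

section Approximation

variable {I : Type uI} [Preorder I]
    {M : I → Type uM} [∀ i, MetricSpace (M i)]
    [∀ i, MeasurableSpace (M i)] [∀ i, BorelSpace (M i)]
    {M₀ : Type uM₀} [MetricSpace M₀] [MeasurableSpace M₀]
    {μ : ∀ i, Measure (M i)} [∀ i, IsFiniteMeasure (μ i)]
    {μ₀ : Measure M₀}
    {φ : ∀ i, M i → M₀}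
    {Y : I → Type uY} [∀ i, MetricSpace (Y i)] {Y₀ : Type uY₀} [MetricSpace Y₀]
    {y : ∀ i, Y i} {y₀ : Y₀}
    {𝔹 : Type uB} [NormedAddCommGroup 𝔹] [NormedSpace ℝ 𝔹]
    {α : ∀ i, Y i → 𝔹} {α₀ : Y₀ → 𝔹}
    {p c C R : ℝ}

/-- At a fixed scale, the Poincaré inequality provides approximate values of `u i` on the balls
around the points of a separated subset of the limit space. -/
theorem eventually_exists_values [∀ i, (μ i).IsOpenPosMeasure]
    (hφ : IsMeasuredGHApprox μ μ₀ φ) (hiso : ∀ i, Isometry (α i)) (hC : 0 ≤ C) (hp : 1 ≤ p)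
    (hc : 1 ≤ c)
    {E : ∀ i, LpMap p (μ i) (y i) → ℝ≥0∞} {ρ : I → ℝ} (hρ : Tendsto ρ atTop (𝓝 0))
    (hP : ∀ i, WeakPoincare c C (ρ i) R (E i)) {U : Ultrafilter I} (hU : (U : Filter I) ≤ atTop)
    (u : ∀ i, LpMap p (μ i) (y i)) {A : ℝ≥0} (hE : ∀ᶠ i in U, E i (u i) ≤ A)
    {r r₁ : ℝ} (hr₁ : r₁ ∈ Set.Ioo 0 r) (hrR : r ≤ R) {D : Finset M₀}
    (hsep : (D : Set M₀).Pairwise fun a b => r ≤ dist a b)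
    {K η : ℝ≥0∞} (hK : (coveringOrder M₀ c r : ℝ≥0∞) ≤ K) (hη : η ≠ 0)
    {l : M₀ → M₀ → ℝ} (hl : ∀ z x, 0 ≤ l z x) (hl1 : ∀ x, ∑ z ∈ D, l z x = 1)
    (hl0 : ∀ z x, r₁ ≤ dist x z → l z x = 0) :
    ∀ᶠ i in U, ∃ w : M₀ → Y i,
      ∫⁻ b, ‖((u i).embed (α i) (hiso i)).1 b -
          ∑ z ∈ D, l z (φ i b) • (α i (w z) - α i (y i))‖ₑ ^ p ∂(μ i) ≤
        ENNReal.ofReal (C * r ^ p) * (K * A) + D.card * η ∧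
      ∀ z ∈ D, ∫⁻ b in φ i ⁻¹' Metric.ball z r₁,
          ‖((u i).embed (α i) (hiso i)).1 b - (α i (w z) - α i (y i))‖ₑ ^ p ∂(μ i) ≤
        ENNReal.ofReal (C * r ^ p) * (K * A) + D.card * η := by
  obtain ⟨hr₁0, hr₁r⟩ := hr₁
  -- Density and distortion each cost less than `(r - r₁) / 4`, together less than `s - r₁ = r - s`.
  -- Hence the preimage of `B(z, r₁)` lies in `B(x z, s)`. As `c ≥ 1`, also `c * s + (r - s) ≤ c *
  -- r`, so overlaps in `M i` are bounded by those in `M₀`.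
  set s : ℝ := (r₁ + r) / 2 with hs
  have hs0 : 0 < s := by linarith
  have hsr : s < r := by linarith
  filter_upwards [hE, hU (hφ.approx ((r - r₁) / 4) (by linarith)),
    hU (hρ.eventually_lt_const hs0)] with i hEi hGH hρi
  obtain ⟨ν, hν, hνE, hPi⟩ := hP i (u i) (hEi.trans_lt ENNReal.coe_lt_top)
  obtain ⟨⟨δ, hδ, hdist⟩, hdense⟩ := hGH
  choose x hx using hdense
  have hover : ∀ b, ({z | z ∈ D ∧ b ∈ Metric.ball (x z) (c * s)}.encard : ℝ≥0∞) ≤ K := by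
    intro b
    refine le_trans ?_ hK
    have h1 : {z | z ∈ D ∧ b ∈ Metric.ball (x z) (c * s)} ⊆
        {z ∈ (D : Set M₀) | φ i b ∈ Metric.ball z (c * r)} := by
      rintro z ⟨hzD, hz⟩
      refine ⟨hzD, ?_⟩
      rw [Metric.mem_ball] at hz ⊢
      have e1 := (abs_le.1 (hdist b (x z))).2
      have e2 := dist_triangle_right (φ i b) z (φ i (x z))
      have e3 := hx z
      nlinarith
    have h2 : {z ∈ (D : Set M₀) | φ i b ∈ Metric.ball z (c * r)}.encard ≤ coveringOrder M₀ c r :=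
      le_iSup_of_le (D : Set M₀) (le_iSup_of_le hsep
        (le_iSup (fun x => {z ∈ (D : Set M₀) | x ∈ Metric.ball z (c * r)}.encard) (φ i b)))
    exact_mod_cast (Set.encard_le_encard h1).trans h2
  obtain ⟨w, hw⟩ := (u i).exists_values_near (hiso i) hν hs0
    (fun z => hPi z s ⟨hρi, by linarith⟩) D x hover hη
  have hw' := hw.trans (show _ ≤ ENNReal.ofReal (C * r ^ p) * (K * A) + D.card * η by
    gcongr
    exact ENNReal.coe_le_coe.1 (hνE.trans hEi))
  have hsub : ∀ z, φ i ⁻¹' Metric.ball z r₁ ⊆ Metric.ball (x z) s := by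
    intro z b hb
    rw [Set.mem_preimage, Metric.mem_ball] at hb
    rw [Metric.mem_ball]
    have e1 := (abs_le.1 (hdist b (x z))).1
    have e2 := dist_triangle (φ i b) z (φ i (x z))
    have e3 := hx z
    linarith
  refine ⟨w, le_trans ?_ hw', fun z hz => le_trans ?_ hw'⟩
  · refine lintegral_enorm_sub_sum_smul_le D (l := fun z b => l z (φ i b)) (fun z b => hl _ _)
      (fun b => hl1 _) (fun z => measurableSet_ball) (fun z _ b hb => hl0 _ _ ?_)
      (AEEqFun.aestronglyMeasurable _) _ hp
    by_contra! h
    exact hb (hsub z h)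
  · exact (lintegral_mono_set (hsub z)).trans (Finset.single_le_sum
      (f := fun z => ∫⁻ b in Metric.ball (x z) s,
        ‖((u i).embed (α i) (hiso i)).1 b - (α i (w z) - α i (y i))‖ₑ ^ p ∂(μ i))
      (fun _ _ => zero_le) hz)

/-- The scale, and with it the finite set `D`, is fixed before passing to the limit. Only finitely
many values then have to converge, and replacing them by their limits yields one continuous map for
all `i`. -/
theorem exists_continuous_approx [CompactSpace M₀] [BorelSpace M₀] [IsFiniteMeasure μ₀]
    [∀ i, (μ i).IsOpenPosMeasure] [μ₀.IsOpenPosMeasure] [ProperSpace Y₀]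
    (hφ : IsMeasuredGHApprox μ μ₀ φ) (hα : IsGHEmbedding y y₀ α α₀) (hp : 1 ≤ p) (hc : 1 ≤ c)
    (hC : 0 < C) (hR : 0 < R) {f : ℝ → ℝ} (hf : f =o[𝓝[>] 0] fun r : ℝ => r ^ (-p))
    (hcov : LocalCoveringOrderLE M₀ c f)
    {E : ∀ i, LpMap p (μ i) (y i) → ℝ≥0∞} {ρ : I → ℝ} (hρ : Tendsto ρ atTop (𝓝 0))
    (hP : ∀ i, WeakPoincare c C (ρ i) R (E i)) {U : Ultrafilter I} (hU : (U : Filter I) ≤ atTop)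
    (u : ∀ i, LpMap p (μ i) (y i)) {A b : ℝ≥0} (hE : ∀ᶠ i in U, E i (u i) ≤ A)
    (hb : ∀ᶠ i in U, eLpNorm ((u i).embed (α i) (hα.isometry i)).1 (ENNReal.ofReal p) (μ i) ≤ b)
    {ε : ℝ} (hε : 0 < ε) :
    ∃ g : C(M₀, 𝔹), ∀ᶠ i in U,
      eLpNorm (fun x => ((u i).embed (α i) (hα.isometry i)).1 x - g (φ i x))
        (ENNReal.ofReal p) (μ i) ≤ ENNReal.ofReal ε := by
  have hp0 : 0 < p := by linarith
  have hq0 : ENNReal.ofReal p ≠ 0 := by simpa using hp0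
  have hq1 : 1 ≤ ENNReal.ofReal p := by simpa using hp
  -- Half of `ε` pays for gluing and half for replacing values by limits; `δ` is again halved
  -- between the Poincaré term and the total slack `D.card * η`.
  set δ : ℝ := (ε / 2) ^ p with hδ
  have hδ0 : 0 < δ := by positivity
  obtain ⟨r, hr0, hrR, hr⟩ := exists_scale hf hC hR A.coe_nonneg (half_pos hδ0)
  obtain ⟨D, hsep, r₁, hr₁, hD⟩ := exists_finite_separated_cover M₀ hr0
  obtain ⟨l, hlc, hl, hl1, hl0⟩ := exists_partition_of_unity_balls D hD
  have hη : 0 < δ / 2 / (D.card + 1) := by positivity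
  have hbound : ENNReal.ofReal (C * r ^ p) * (ENNReal.ofReal |f r| * A) +
      D.card * ENNReal.ofReal (δ / 2 / (D.card + 1)) ≤ ENNReal.ofReal δ := by
    rw [← ENNReal.ofReal_coe_nnreal, ← ENNReal.ofReal_natCast, ← ENNReal.ofReal_mul (by positivity),
      ← ENNReal.ofReal_mul (by positivity), ← ENNReal.ofReal_mul (by positivity),
      ← ENNReal.ofReal_add (by positivity) (by positivity)]
    refine ENNReal.ofReal_le_ofReal ?_
    have : (D.card : ℝ) * (δ / 2 / (D.card + 1)) ≤ δ / 2 := by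
      rw [mul_div_assoc', div_le_iff₀ (by positivity)]
      nlinarith
    linarith
  have hev := eventually_exists_values hφ hα.isometry hC.le hp hc hρ hP hU u hE hr₁ hrR hsep
    ((hcov r hr0).trans (ENNReal.ofReal_le_ofReal (le_abs_self _)))
    (ENNReal.ofReal_pos.2 hη).ne' hl hl1 hl0
  have hne : ∀ i, Nonempty (Y i) := fun i => ⟨y i⟩
  obtain ⟨w, hw⟩ : ∃ w : ∀ i, M₀ → Y i, ∀ᶠ i in U,
      ∫⁻ b, ‖((u i).embed (α i) (hα.isometry i)).1 b -
          ∑ z ∈ D, l z (φ i b) • (α i (w i z) - α i (y i))‖ₑ ^ p ∂(μ i) ≤ ENNReal.ofReal δ ∧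
      ∀ z ∈ D, ∫⁻ b in φ i ⁻¹' Metric.ball z r₁,
          ‖((u i).embed (α i) (hα.isometry i)).1 b - (α i (w i z) - α i (y i))‖ₑ ^ p ∂(μ i) ≤
        ENNReal.ofReal δ := by
    obtain ⟨w, hw⟩ := Filter.skolem.1 hev
    exact ⟨w, hw.mono fun i hi => ⟨hi.1.trans hbound, fun z hz => (hi.2 z hz).trans hbound⟩⟩
  have hlim : ∀ z, ∃ w₀, z ∈ D → Tendsto (fun i => α i (w i z) - α i (y i)) U (𝓝 w₀) := by
    intro z
    by_cases hz : z ∈ D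
    swap
    · exact ⟨0, fun h => (hz h).elim⟩
    obtain ⟨m, hm0, hm⟩ := hφ.eventually_lt_measure_preimage z hr₁.1
    obtain ⟨i₀, hi₀⟩ := (hm.filter_mono hU).exists
    have hmt : m ≠ ∞ := hi₀.ne_top
    -- The value at `z` is close to `u i` on a set of measure more than `m`, and `u i` is bounded in
    -- `L^p`; this bounds the value independently of `i`.
    set X : ℝ≥0∞ := (2 ^ (p - 1) * (ENNReal.ofReal δ + (b : ℝ≥0∞) ^ p) / m) ^ (1 / p) with hX
    have hXt : X ≠ ∞ := by
      have h1 : (b : ℝ≥0∞) ^ p ≠ ∞ := ENNReal.rpow_ne_top_of_nonneg hp0.le ENNReal.coe_ne_top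
      have h2 : (2 : ℝ≥0∞) ^ (p - 1) ≠ ∞ := ENNReal.rpow_ne_top_of_nonneg (by linarith) (by simp)
      refine ENNReal.rpow_ne_top_of_nonneg (by positivity) (ENNReal.div_ne_top ?_ hm0.ne')
      exact ENNReal.mul_ne_top h2 (ENNReal.add_ne_top.2 ⟨ENNReal.ofReal_ne_top, h1⟩)
    obtain ⟨w₀, hw₀⟩ := hα.exists_tendsto_of_bounded hU (w := fun i => α i (w i z))
      (b := X.toReal + (‖α₀ y₀‖ + 1)) (Eventually.of_forall fun i => ⟨_, rfl⟩) (by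
        filter_upwards [hw, hb, hU hm,
          (hα.base.norm.mono_left hU).eventually_lt_const (lt_add_one _)] with i h1 h2 h3 h4
        have h5 : ‖α i (w i z) - α i (y i)‖ₑ ≤ X := by
          refine enorm_le_of_setLIntegral_sub_le hp (AEEqFun.aestronglyMeasurable _) hm0.ne'
            h3.le hmt (h1.2 z hz) ?_
          rw [eLpNorm_eq_lintegral_rpow_enorm_toReal hq0 ENNReal.ofReal_ne_top,
            ENNReal.toReal_ofReal hp0.le, one_div, ENNReal.rpow_inv_le_iff hp0] at h2
          exact h2
        have h6 : ‖α i (w i z) - α i (y i)‖ ≤ X.toReal := by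
          rw [← toReal_enorm]
          exact ENNReal.toReal_mono hXt h5
        have h7 := norm_le_norm_sub_add (α i (w i z)) (α i (y i))
        linarith)
    exact ⟨w₀ - α₀ y₀, fun _ => hw₀.sub (hα.base.mono_left hU)⟩
  choose w₀ hw₀ using hlim
  have hcont : ∀ W : M₀ → 𝔹, Continuous fun x => ∑ z ∈ D, l z x • W z := fun W =>
    continuous_finsetSum _ fun z _ => (hlc z).smul continuous_const
  refine ⟨⟨_, hcont w₀⟩, ?_⟩
  -- Eventually `μ i` has mass below `μ₀ Set.univ + 1`, so `V` turns uniform bounds on `M i` into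
  -- `L^p` bounds.
  set V : ℝ≥0∞ := (μ₀ Set.univ + 1) ^ (ENNReal.ofReal p).toReal⁻¹ with hV
  have hVt : V ≠ ∞ := by
    refine ENNReal.rpow_ne_top_of_nonneg (by positivity) ?_
    finiteness
  set θ : ℝ := ε / 2 / (V.toReal + 1) with hθ
  have hθ0 : 0 < θ := by positivity
  have hclose : ∀ᶠ i in U, ∀ z ∈ D, ‖(α i (w i z) - α i (y i)) - w₀ z‖ ≤ θ := by
    rw [Finset.eventually_all]
    intro z hz
    filter_upwards [Metric.tendsto_nhds.1 (hw₀ z hz) θ hθ0] with i hi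
    rw [← dist_eq_norm]
    exact hi.le
  filter_upwards [hw, hclose, hU (hφ.tendsto_measure_univ.eventually_lt_const
    (ENNReal.lt_add_right (measure_ne_top μ₀ Set.univ) one_ne_zero))] with i h1 h2 h3
  set v := ((u i).embed (α i) (hα.isometry i)).1
  set W : M₀ → 𝔹 := fun z => α i (w i z) - α i (y i)
  have hm : ∀ W : M₀ → 𝔹,
      AEStronglyMeasurable (fun x => ∑ z ∈ D, l z (φ i x) • W z) (μ i) := fun W =>
    ((hcont W).stronglyMeasurable.comp_measurable (hφ.measurable i)).aestronglyMeasurable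
  have e1 : eLpNorm (fun x => v x - ∑ z ∈ D, l z (φ i x) • W z) (ENNReal.ofReal p) (μ i) ≤
      ENNReal.ofReal (ε / 2) := by
    rw [eLpNorm_eq_lintegral_rpow_enorm_toReal hq0 ENNReal.ofReal_ne_top,
      ENNReal.toReal_ofReal hp0.le, one_div, ENNReal.rpow_inv_le_iff hp0,
      ENNReal.ofReal_rpow_of_nonneg (by positivity) hp0.le]
    exact h1.1
  have e2 : eLpNorm (fun x => ∑ z ∈ D, l z (φ i x) • W z - ∑ z ∈ D, l z (φ i x) • w₀ z)
      (ENNReal.ofReal p) (μ i) ≤ ENNReal.ofReal (ε / 2) := by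
    refine (eLpNorm_le_of_ae_bound (C := θ) (ae_of_all _ fun x => ?_)).trans ?_
    · rw [← Finset.sum_sub_distrib]
      simp only [← smul_sub]
      refine (norm_sum_le _ _).trans ?_
      calc _ ≤ ∑ z ∈ D, l z (φ i x) * θ := by
            refine Finset.sum_le_sum fun z hz => ?_
            rw [norm_smul, Real.norm_of_nonneg (hl _ _)]
            exact mul_le_mul_of_nonneg_left (h2 z hz) (hl _ _)
        _ = θ := by rw [← Finset.sum_mul, hl1, one_mul]
    · calc _ ≤ V * ENNReal.ofReal θ := by
            gcongr
            exact ENNReal.rpow_le_rpow h3.le (by positivity)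
        _ = ENNReal.ofReal (V.toReal * θ) := by
            rw [ENNReal.ofReal_mul ENNReal.toReal_nonneg, ENNReal.ofReal_toReal hVt]
        _ ≤ _ := by
            refine ENNReal.ofReal_le_ofReal ?_
            rw [hθ, mul_div_assoc', div_le_iff₀ (by positivity)]
            nlinarith
  have e3 := eLpNorm_add_le (μ := μ i) ((AEEqFun.aestronglyMeasurable v).sub (hm W))
    ((hm W).sub (hm w₀)) hq1
  calc _ = _ := by
        congr 1
        ext x
        exact (sub_add_sub_cancel (v x) (∑ z ∈ D, l z (φ i x) • W z) _).symm
    _ ≤ _ := e3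
    _ ≤ ENNReal.ofReal (ε / 2) + ENNReal.ofReal (ε / 2) := add_le_add e1 e2
    _ = ENNReal.ofReal ε := by
        rw [← ENNReal.ofReal_add (by positivity) (by positivity), add_halves]

end Approximation

theorem tendsto_nhds_induced_iff {X : Type uX} {Z : Type uX₀} (τ : TopologicalSpace Z) (g : X → Z)
    {J : Type*} (h : J → X) (F : Filter J) (x : X) :
    Tendsto h F (@nhds _ (τ.induced g) x) ↔ Tendsto (g ∘ h) F (@nhds _ τ (g x)) := by
  rw [nhds_induced, tendsto_comap_iff]

/-! ### Strong limits and their values -/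

section Limit

variable {I : Type uI} [Preorder I]
    {M : I → Type uM} [∀ i, MetricSpace (M i)] [∀ i, MeasurableSpace (M i)]
    {M₀ : Type uM₀} [MetricSpace M₀] [CompactSpace M₀] [MeasurableSpace M₀] [BorelSpace M₀]
    {μ : ∀ i, Measure (M i)} {μ₀ : Measure M₀} {φ : ∀ i, M i → M₀}
    {𝔹 : Type uB} [NormedAddCommGroup 𝔹] {p : ℝ}

theorem eLpNorm_sub_le_add {Ω : Type*} [MeasurableSpace Ω] {ν : Measure Ω} {f g h : Ω → 𝔹}
    (hf : AEStronglyMeasurable f ν) (hg : AEStronglyMeasurable g ν)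
    (hh : AEStronglyMeasurable h ν) (hp : 1 ≤ p) :
    eLpNorm (fun x => f x - h x) (ENNReal.ofReal p) ν ≤
      eLpNorm (fun x => f x - g x) (ENNReal.ofReal p) ν +
        eLpNorm (fun x => g x - h x) (ENNReal.ofReal p) ν := by
  have := eLpNorm_add_le (hf.sub hg) (hg.sub hh) (by simpa using hp : 1 ≤ ENNReal.ofReal p)
  rwa [sub_add_sub_cancel] at this

theorem eLpNorm_sub_comm' {Ω : Type*} [MeasurableSpace Ω] {ν : Measure Ω} (f g : Ω → 𝔹)
    (q : ℝ≥0∞) : eLpNorm (fun x => f x - g x) q ν = eLpNorm (fun x => g x - f x) q ν :=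
  eLpNorm_sub_comm f g q ν

theorem IsMeasuredGHApprox.aestronglyMeasurable_comp (hφ : IsMeasuredGHApprox μ μ₀ φ)
    (g : C(M₀, 𝔹)) (i : I) : AEStronglyMeasurable (fun x => g (φ i x)) (μ i) :=
  (g.continuous.stronglyMeasurable.comp_measurable (hφ.measurable i)).aestronglyMeasurable

variable [∀ i, IsFiniteMeasure (μ i)] [IsFiniteMeasure μ₀]

/-- A family of maps that is asymptotically approximated by continuous maps on the limit space has
a strong `L^p`-limit. -/
theorem IsMeasuredGHApprox.exists_strong_limit [CompleteSpace 𝔹]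
    (hφ : IsMeasuredGHApprox μ μ₀ φ) (hp : 1 ≤ p)
    {U : Ultrafilter I} (hU : (U : Filter I) ≤ atTop) {w : ∀ i, M i → 𝔹}
    (hw : ∀ i, AEStronglyMeasurable (w i) (μ i))
    (happ : ∀ ε : ℝ, 0 < ε → ∃ g : C(M₀, 𝔹), ∀ᶠ i in U,
      eLpNorm (fun x => w i x - g (φ i x)) (ENNReal.ofReal p) (μ i) ≤ ENNReal.ofReal ε) :
    ∃ v : M₀ → 𝔹, MemLp v (ENNReal.ofReal p) μ₀ ∧ ∀ ε : ℝ, 0 < ε → ∃ g : C(M₀, 𝔹),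
      eLpNorm (fun x => v x - g x) (ENNReal.ofReal p) μ₀ ≤ ENNReal.ofReal ε ∧
      ∀ᶠ i in U,
        eLpNorm (fun x => w i x - g (φ i x)) (ENNReal.ofReal p) (μ i) ≤ ENNReal.ofReal ε := by
  have hp0 : 0 < p := by linarith
  choose g hg using fun n : ℕ => happ ((1 / 2) ^ n) (by positivity)
  have hmem : ∀ n, MemLp (g n) (ENNReal.ofReal p) μ₀ := fun n =>
    MemLp.of_bound (g n).continuous.aestronglyMeasurable ‖g n‖
      (ae_of_all _ fun x => (g n).norm_coe_le_norm x)
  have hdist : ∀ n m, eLpNorm (g n - g m : M₀ → 𝔹) (ENNReal.ofReal p) μ₀ ≤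
      ENNReal.ofReal ((1 / 2) ^ n + (1 / 2) ^ m) := by
    intro n m
    -- On `M i` both maps are compared with `w i`; the norm of the continuous difference then passes
    -- to `M₀`.
    refine le_of_tendsto ((hφ.tendsto_eLpNorm hp0 (g n - g m)).mono_left hU) ?_
    filter_upwards [hg n, hg m] with i h1 h2
    rw [eLpNorm_sub_comm'] at h1
    refine (eLpNorm_sub_le_add (hφ.aestronglyMeasurable_comp (g n) i) (hw i)
      (hφ.aestronglyMeasurable_comp (g m) i) hp).trans ?_
    rw [ENNReal.ofReal_add (by positivity) (by positivity)]
    exact add_le_add h1 h2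
  -- The Cauchy criterion asks for a strict bound, so 4 is used where the estimate gives 2.
  have hB : ∑' n : ℕ, ENNReal.ofReal (4 * (1 / 2) ^ n) ≠ ∞ :=
    (summable_geometric_two.mul_left 4).tsum_ofReal_ne_top
  obtain ⟨v, hv, hlim⟩ := Lp.cauchy_complete_eLpNorm (by simpa using hp) hmem hB (by
    intro N n m hn hm
    refine (hdist n m).trans_lt ((ENNReal.ofReal_lt_ofReal_iff (by positivity)).2 ?_)
    have h1 : (1 / 2 : ℝ) ^ n ≤ (1 / 2) ^ N :=
      pow_le_pow_of_le_one (by norm_num) (by norm_num) hn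
    have h2 : (1 / 2 : ℝ) ^ m ≤ (1 / 2) ^ N :=
      pow_le_pow_of_le_one (by norm_num) (by norm_num) hm
    have h3 : (0 : ℝ) < (1 / 2) ^ N := by positivity
    linarith)
  refine ⟨v, hv, fun ε hε => ?_⟩
  have h1 := hlim.eventually_le_const (ENNReal.ofReal_pos.2 hε)
  have h2 := (tendsto_pow_atTop_nhds_zero_of_lt_one (r := (1 / 2 : ℝ)) (by norm_num)
    (by norm_num)).eventually_le_const hε
  obtain ⟨n, hn1, hn2⟩ := (h1.and h2).exists
  refine ⟨g n, ?_, (hg n).mono fun i hi => hi.trans (ENNReal.ofReal_le_ofReal hn2)⟩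
  rw [eLpNorm_sub_comm']
  exact hn1

/-- The distance to `A`, cut off outside the ball of radius `T`. -/
def truncInfDist (A : Set 𝔹) (T : ℝ) (w : 𝔹) : ℝ :=
  max 0 (min (Metric.infDist w A) (T - ‖w‖))

theorem truncInfDist_nonneg (A : Set 𝔹) (T : ℝ) (w : 𝔹) : 0 ≤ truncInfDist A T w :=
  le_max_left _ _

theorem abs_truncInfDist_sub_le (A : Set 𝔹) (T : ℝ) (w w' : 𝔹) :
    |truncInfDist A T w - truncInfDist A T w'| ≤ ‖w - w'‖ := by
  have h1 : LipschitzWith 1 fun w : 𝔹 => T - ‖w‖ := by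
    refine LipschitzWith.of_dist_le_mul fun x y => ?_
    rw [NNReal.coe_one, one_mul, Real.dist_eq, sub_sub_sub_cancel_left, abs_sub_comm, dist_eq_norm]
    exact abs_norm_sub_norm_le x y
  have h2 := (LipschitzWith.const (0 : ℝ)).max ((Metric.lipschitz_infDist_pt A).min h1)
  have h3 := h2.dist_le_mul w w'
  simpa [Real.dist_eq, dist_eq_norm, truncInfDist] using h3

theorem mem_of_truncInfDist_eq_zero {A : Set 𝔹} (hA : IsClosed A) (hne : A.Nonempty) {w : 𝔹}
    (h : ∀ n : ℕ, truncInfDist A n w = 0) : w ∈ A := by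
  obtain ⟨n, hn⟩ := exists_nat_gt ‖w‖
  rw [hA.mem_iff_infDist_zero hne]
  have h1 := h n
  have h2 : min (Metric.infDist w A) (n - ‖w‖) ≤ 0 := h1 ▸ le_max_right _ _
  rcases min_le_iff.1 h2 with h3 | h3
  · exact le_antisymm h3 Metric.infDist_nonneg
  · linarith

section Range

variable {Y : I → Type uY} [∀ i, MetricSpace (Y i)] {Y₀ : Type uY₀} [MetricSpace Y₀]
    {y : ∀ i, Y i} {y₀ : Y₀} {α : ∀ i, Y i → 𝔹} {α₀ : Y₀ → 𝔹}

/-- Hausdorff convergence controls only bounded parts; the truncation vanishes on the rest, which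
makes the estimate uniform on all of `Y i`. -/
theorem IsGHEmbedding.eventually_truncInfDist_le (hα : IsGHEmbedding y y₀ α α₀) (T : ℝ) {η : ℝ}
    (hη : 0 < η) : ∀ᶠ i in atTop, ∀ z : Y i, truncInfDist (Set.range α₀) T (α i z) ≤ η := by
  filter_upwards [hα.hausdorff 0 (|T| + 1) η (by positivity) hη] with i hi z
  refine max_le hη.le ?_
  by_cases hz : ‖α i z‖ < |T| + 1
  · obtain ⟨w, hw, hzw⟩ := Metric.mem_thickening_iff.1
      (hi.1 ⟨⟨z, rfl⟩, mem_ball_zero_iff.2 hz⟩)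
    exact (min_le_left _ _).trans ((Metric.infDist_le_dist_of_mem hw).trans hzw.le)
  · refine (min_le_right _ _).trans ?_
    have := le_abs_self T
    linarith

/-- A strong `L^p`-limit of maps into the `Y i` takes values in `Y₀`. -/
theorem IsGHEmbedding.ae_mem_range_of_strong_limit [CompleteSpace Y₀]
    (hα : IsGHEmbedding y y₀ α α₀) (hφ : IsMeasuredGHApprox μ μ₀ φ) (hp : 1 ≤ p)
    {U : Ultrafilter I} (hU : (U : Filter I) ≤ atTop) {w : ∀ i, M i → 𝔹}
    (hw : ∀ i, AEStronglyMeasurable (w i) (μ i))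
    (hwr : ∀ i, ∀ᵐ x ∂(μ i), w i x + α i (y i) ∈ Set.range (α i))
    {v : M₀ → 𝔹} (hv : AEStronglyMeasurable v μ₀)
    (happ : ∀ ε : ℝ, 0 < ε → ∃ g : C(M₀, 𝔹),
      eLpNorm (fun x => v x - g x) (ENNReal.ofReal p) μ₀ ≤ ENNReal.ofReal ε ∧
      ∀ᶠ i in U,
        eLpNorm (fun x => w i x - g (φ i x)) (ENNReal.ofReal p) (μ i) ≤ ENNReal.ofReal ε) :
    ∀ᵐ x ∂μ₀, v x + α₀ y₀ ∈ Set.range α₀ := by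
  have hp0 : 0 < p := by linarith
  have hq0 : ENNReal.ofReal p ≠ 0 := by simpa using hp0
  suffices h : ∀ n : ℕ, ∀ᵐ x ∂μ₀, truncInfDist (Set.range α₀) n (v x + α₀ y₀) = 0 by
    filter_upwards [ae_all_iff.2 h] with x hx
    exact mem_of_truncInfDist_eq_zero hα.isometry₀.isClosedEmbedding.isClosed_range
      ⟨_, ⟨y₀, rfl⟩⟩ hx
  intro n
  set h : 𝔹 → ℝ := fun b => truncInfDist (Set.range α₀) n (b + α₀ y₀) with hh
  have hlip : ∀ a b, ‖h a - h b‖ ≤ ‖a - b‖ := fun a b => by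
    have := abs_truncInfDist_sub_le (Set.range α₀) n (a + α₀ y₀) (b + α₀ y₀)
    rwa [add_sub_add_right_eq_sub] at this
  have hcont : Continuous h := by
    refine (LipschitzWith.of_dist_le_mul (K := 1) fun a b => ?_).continuous
    simpa [dist_eq_norm] using hlip a b
  set V : ℝ≥0∞ := (μ₀ Set.univ + 1) ^ (ENNReal.ofReal p).toReal⁻¹ with hV
  have hVt : V ≠ ∞ := by
    refine ENNReal.rpow_ne_top_of_nonneg (by positivity) ?_
    finiteness
  -- As `h` is 1-Lipschitz, passing from `v` to `g` and from `g ∘ φ i` to `w i` costs `ε` each. The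
  -- pointwise bound `2 * ε` on `h ∘ w i` combines the Hausdorff estimate with the shift between `α
  -- i (y i)` and `α₀ y₀`.
  have hsmall : ∀ ε : ℝ, 0 < ε → eLpNorm (fun x => h (v x)) (ENNReal.ofReal p) μ₀ ≤
      ENNReal.ofReal (ε + (ε + V.toReal * (2 * ε))) := by
    intro ε hε
    obtain ⟨g, hg1, hg2⟩ := happ ε hε
    have h1 : eLpNorm (fun x => h (g x)) (ENNReal.ofReal p) μ₀ ≤
        ENNReal.ofReal (ε + V.toReal * (2 * ε)) := by
      refine le_of_tendsto
        ((hφ.tendsto_eLpNorm hp0 (⟨_, hcont.comp g.continuous⟩ : C(M₀, ℝ))).mono_left hU) ?_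
      filter_upwards [hg2, hU (hα.eventually_truncInfDist_le n hε),
        hU (Metric.tendsto_nhds.1 hα.base ε hε),
        hU (hφ.tendsto_measure_univ.eventually_lt_const
          (ENNReal.lt_add_right (measure_ne_top μ₀ Set.univ) one_ne_zero))] with i e1 e2 e3 e4
      have e5 : eLpNorm (fun x => h (w i x)) (ENNReal.ofReal p) (μ i) ≤
          ENNReal.ofReal (V.toReal * (2 * ε)) := by
        refine (eLpNorm_le_of_ae_bound (C := 2 * ε) ?_).trans ?_
        · filter_upwards [hwr i] with x hx
          obtain ⟨z, hz⟩ := hx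
          rw [Real.norm_of_nonneg (truncInfDist_nonneg _ _ _)]
          have k1 := e2 z
          have k2 := abs_truncInfDist_sub_le (Set.range α₀) n (w i x + α₀ y₀) (α i z)
          rw [hz, add_sub_add_left_eq_sub, ← dist_eq_norm, dist_comm] at k2
          have k3 := (abs_le.1 k2).2
          rw [hz] at k1
          change truncInfDist (Set.range α₀) n (w i x + α₀ y₀) ≤ 2 * ε
          linarith
        · rw [ENNReal.ofReal_mul ENNReal.toReal_nonneg, ENNReal.ofReal_toReal hVt]
          gcongr
          exact ENNReal.rpow_le_rpow e4.le (by positivity)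
      have e6 : eLpNorm (fun x => h (g (φ i x)) - h (w i x)) (ENNReal.ofReal p) (μ i) ≤
          ENNReal.ofReal ε := by
        rw [eLpNorm_sub_comm'] at e1
        exact (eLpNorm_mono fun x => hlip _ _).trans e1
      have e7 := eLpNorm_sub_le_add (hcont.comp_aestronglyMeasurable
        (hφ.aestronglyMeasurable_comp g i)) (hcont.comp_aestronglyMeasurable (hw i))
        (aestronglyMeasurable_const (b := (0 : ℝ))) hp
      simp only [sub_zero] at e7
      rw [ENNReal.ofReal_add hε.le (by positivity)]
      exact e7.trans (add_le_add e6 e5)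
    have h2 : eLpNorm (fun x => h (v x) - h (g x)) (ENNReal.ofReal p) μ₀ ≤ ENNReal.ofReal ε :=
      (eLpNorm_mono fun x => hlip _ _).trans hg1
    have h3 := eLpNorm_sub_le_add (hcont.comp_aestronglyMeasurable hv)
      (hcont.comp_aestronglyMeasurable (g.continuous.aestronglyMeasurable (μ := μ₀)))
      (aestronglyMeasurable_const (b := (0 : ℝ))) hp
    simp only [sub_zero] at h3
    rw [ENNReal.ofReal_add hε.le (by positivity)]
    exact h3.trans (add_le_add h2 h1)
  have hzero : eLpNorm (fun x => h (v x)) (ENNReal.ofReal p) μ₀ = 0 := by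
    refine le_antisymm ?_ zero_le
    have ht : Tendsto (fun ε : ℝ => ENNReal.ofReal (ε + (ε + V.toReal * (2 * ε)))) (𝓝[>] 0)
        (𝓝 0) := by
      have : Continuous fun ε : ℝ => ENNReal.ofReal (ε + (ε + V.toReal * (2 * ε))) :=
        ENNReal.continuous_ofReal.comp (by fun_prop)
      simpa using (this.tendsto 0).mono_left nhdsWithin_le_nhds
    exact ge_of_tendsto ht (eventually_mem_nhdsWithin.mono hsmall)
  exact (eLpNorm_eq_zero_iff (hcont.comp_aestronglyMeasurable hv) hq0).1 hzero

end Range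

/-- Strong `L^p`-limits are limits in the `L^p`-topology. -/
theorem IsMeasuredGHApprox.tendsto_banachLpTopology (hφ : IsMeasuredGHApprox μ μ₀ φ) (hp : 1 ≤ p)
    {U : Ultrafilter I} (hU : (U : Filter I) ≤ atTop) (w : ∀ i, LpMap p (μ i) (0 : 𝔹))
    (v : LpMap p μ₀ (0 : 𝔹))
    (happ : ∀ ε : ℝ, 0 < ε → ∃ g : C(M₀, 𝔹),
      eLpNorm (fun x => v.1 x - g x) (ENNReal.ofReal p) μ₀ ≤ ENNReal.ofReal ε ∧
      ∀ᶠ i in U,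
        eLpNorm (fun x => (w i).1 x - g (φ i x)) (ENNReal.ofReal p) (μ i) ≤ ENNReal.ofReal ε) :
    Tendsto (fun i => (Sum.inl ⟨i, w i⟩ : (Σ i, LpMap p (μ i) (0 : 𝔹)) ⊕ LpMap p μ₀ (0 : 𝔹))) U
      (@nhds _ (banachLpTopology p μ μ₀ φ) (Sum.inr v)) := by
  have hp0 : 0 < p := by linarith
  rw [TopologicalSpace.tendsto_nhds_generateFrom_iff]
  rintro O (⟨i, w', δ, rfl⟩ | ⟨g, δ, i₀, rfl⟩) hvO
  -- Open sets of the first kind lie in the summands over `M i` and miss the limit point.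
  · simp at hvO
  have hvg : lpDist p μ₀ v.1 g < δ := by
    rcases hvO with ⟨_, -, h⟩ | ⟨v', hv', h⟩
    · cases h
    · cases h; exact hv'
  rw [lpDist_eq_eLpNorm hp0] at hvg
  set a := eLpNorm (fun x => v.1 x - g x) (ENNReal.ofReal p) μ₀
  obtain ⟨ε, hε, hεδ⟩ : ∃ ε : ℝ, 0 < ε ∧
      ENNReal.ofReal ε + (ENNReal.ofReal ε + a) < δ := by
    have ht : Tendsto (fun ε : ℝ => ENNReal.ofReal ε + (ENNReal.ofReal ε + a)) (𝓝[>] 0)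
        (𝓝 a) := by
      have : Continuous fun ε : ℝ => ENNReal.ofReal ε + (ENNReal.ofReal ε + a) :=
        ENNReal.continuous_ofReal.add (ENNReal.continuous_ofReal.add continuous_const)
      simpa using (this.tendsto 0).mono_left nhdsWithin_le_nhds
    obtain ⟨ε, h1, h2⟩ := ((ht.eventually_lt_const hvg).and eventually_mem_nhdsWithin).exists
    exact ⟨ε, h2, h1⟩
  obtain ⟨g', hg1, hg2⟩ := happ ε hε
  -- The center `g` of the neighbourhood is compared with `g'` through `v` on `M₀`; the norm of `g'
  -- - g` then transfers to `M i`.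
  have h1 : eLpNorm (g' - g : C(M₀, 𝔹)) (ENNReal.ofReal p) μ₀ ≤ ENNReal.ofReal ε + a := by
    rw [eLpNorm_sub_comm'] at hg1
    exact (eLpNorm_sub_le_add g'.continuous.aestronglyMeasurable v.1.aestronglyMeasurable
      g.continuous.aestronglyMeasurable hp).trans (add_le_add hg1 le_rfl)
  have h2 : ENNReal.ofReal ε + eLpNorm (g' - g : C(M₀, 𝔹)) (ENNReal.ofReal p) μ₀ < δ :=
    (add_le_add le_rfl h1).trans_lt hεδ
  have h3 := (((hφ.tendsto_eLpNorm hp0 (g' - g)).mono_left hU).const_add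
    (ENNReal.ofReal ε)).eventually_lt_const h2
  filter_upwards [h3, hg2, hU (eventually_ge_atTop i₀)] with i e1 e2 e3
  refine Or.inl ⟨⟨i, w i⟩, ⟨e3, ?_⟩, rfl⟩
  rw [lpDist_eq_eLpNorm hp0]
  exact ((eLpNorm_sub_le_add (w i).1.aestronglyMeasurable (hφ.aestronglyMeasurable_comp g' i)
    (hφ.aestronglyMeasurable_comp g i) hp).trans (add_le_add e2 le_rfl)).trans_lt e1

end Limit

/-! ### Return to maps into `Y₀` and conclusion -/

/-- A map in `L^p_0(M, 𝔹)` with values in the translate of `Y` comes from `L^p_y(M, Y)`. -/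
theorem LpMap.exists_embed_ae_eq {M : Type uM} {Y : Type uY} [MeasurableSpace M] [MetricSpace Y]
    {𝔹 : Type uB} [NormedAddCommGroup 𝔹] {p : ℝ} (hp : 0 < p) {μ : Measure M} {y : Y}
    {a : Y → 𝔹} (ha : Isometry a) {v : M → 𝔹} (hv : MemLp v (ENNReal.ofReal p) μ)
    (hr : ∀ᵐ x ∂μ, v x + a y ∈ Set.range a) :
    ∃ u : LpMap p μ y, (u.embed a ha).1 =ᵐ[μ] v := by
  have hne : Nonempty Y := ⟨y⟩
  let f : M → Y := fun x => Function.invFun a (v x + a y)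
  have haf : ∀ᵐ x ∂μ, a (f x) = v x + a y := by
    filter_upwards [hr] with x hx
    exact Function.invFun_eq hx
  have hf : AEStronglyMeasurable f μ := by
    -- The chosen inverse need not be measurable; measurability is tested after composing with the
    -- embedding `a`.
    rw [← ha.isEmbedding.aestronglyMeasurable_comp_iff]
    exact (hv.1.add aestronglyMeasurable_const).congr (haf.mono fun x hx => hx.symm)
  have hu : lpDist p μ (AEEqFun.mk f hf) (fun _ => y) < ∞ := by
    have : lpDist p μ (AEEqFun.mk f hf) (fun _ => y) = lpDist p μ v (fun _ => (0 : 𝔹)) := by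
      unfold lpDist
      congr 1
      refine lintegral_congr_ae ?_
      filter_upwards [haf, AEEqFun.coeFn_mk f hf] with x h1 h2
      rw [h2, ← ha.edist_eq, h1, edist_eq_enorm_sub, add_sub_cancel_right, edist_zero_right]
    rw [this, lpDist_eq_eLpNorm hp]
    simpa using hv.2
  refine ⟨⟨AEEqFun.mk f hf, hu⟩, ?_⟩
  filter_upwards [haf, AEEqFun.coeFn_mk f hf, LpMap.coeFn_embed ha ⟨AEEqFun.mk f hf, hu⟩]
    with x h1 h2 h3
  rw [h3, h2, h1, add_sub_cancel_right]

end

theorem theorem4p6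
    {I : Type uI} [Preorder I] [IsDirectedOrder I] [Nonempty I]
    {M : I → Type uM} [∀ i, MetricSpace (M i)] [∀ i, CompactSpace (M i)]
    [∀ i, MeasurableSpace (M i)] [∀ i, BorelSpace (M i)]
    {M₀ : Type uM₀} [MetricSpace M₀] [CompactSpace M₀] [MeasurableSpace M₀] [BorelSpace M₀]
    (μ : ∀ i, Measure (M i)) [∀ i, IsFiniteMeasure (μ i)] [∀ i, (μ i).IsOpenPosMeasure]
    (μ₀ : Measure M₀) [IsFiniteMeasure μ₀] [μ₀.IsOpenPosMeasure]
    (φ : ∀ i, M i → M₀) (hφ : IsMeasuredGHApprox μ μ₀ φ)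
    {Y : I → Type uY} [∀ i, MetricSpace (Y i)] [∀ i, ProperSpace (Y i)]
    {Y₀ : Type uY₀} [MetricSpace Y₀] [ProperSpace Y₀]
    (y : ∀ i, Y i) (y₀ : Y₀) (hY : PointedGHTendsto y y₀)
    {𝔹 : Type uB} [NormedAddCommGroup 𝔹] [NormedSpace ℝ 𝔹] [CompleteSpace 𝔹]
    (α : ∀ i, Y i → 𝔹) (α₀ : Y₀ → 𝔹) (hα : IsGHEmbedding y y₀ α α₀)
    (p c C R : ℝ) (hp : 1 ≤ p) (hc : 1 ≤ c) (hC : 0 < C) (hR : 0 < R)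
    (f : ℝ → ℝ) (hf : f =o[𝓝[>] 0] fun r : ℝ => r ^ (-p))
    (hcov : LocalCoveringOrderLE M₀ c f)
    (E : ∀ i, LpMap p (μ i) (y i) → ℝ≥0∞)
    (ρ : I → ℝ) (hρ : Tendsto ρ atTop (𝓝 0)) (hρR : ∀ i, 0 ≤ ρ i ∧ ρ i ≤ R)
    (hP : ∀ i, WeakPoincare c C (ρ i) R (E i)) :
    AsymptoticallyCompact (fun i u v => lpDist p (μ i) u.1 v.1)
      (lpTopology p μ μ₀ φ hα) E := by
  have hp0 : 0 < p := by linarith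
  rintro u ⟨o, o₀, ho, b, hb⟩ hE
  let U : Ultrafilter I := Ultrafilter.of atTop
  have hU : (U : Filter I) ≤ atTop := Ultrafilter.of_le _
  obtain ⟨A, hEA, hA⟩ := exists_between hE
  lift A to ℝ≥0 using hA.ne
  have hEU : ∀ᶠ i in U, E i (u i) ≤ A :=
    hU ((eventually_lt_of_limsup_lt hEA).mono fun i hi => hi.le)
  -- The net is bounded in `L^p` because `o` is.
  obtain ⟨b', hb'⟩ : ∃ b' : ℝ≥0, ∀ᶠ i in U,
      eLpNorm ((u i).embed (α i) (hα.isometry i)).1 (ENNReal.ofReal p) (μ i) ≤ b' := by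
    rw [tendsto_nhds_induced_iff, TopologicalSpace.tendsto_nhds_generateFrom_iff] at ho
    set B : ℝ≥0∞ := lpDist p μ₀ (o₀.embed α₀ hα.isometry₀).1 (0 : C(M₀, 𝔹)) with hB
    have hBt : B ≠ ∞ := (o₀.embed α₀ hα.isometry₀).2.ne
    -- The neighbourhood centered at the zero map with radius `B + 1` contains the limit of `o`, and
    -- so eventually bounds `o i`.
    have h1 := ho _ (Or.inr ⟨(0 : C(M₀, 𝔹)), B + 1, Classical.arbitrary I, rfl⟩)
      (Or.inr ⟨_, ENNReal.lt_add_right hBt one_ne_zero, rfl⟩)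
    refine ⟨b + (B + 1).toNNReal, ?_⟩
    filter_upwards [hU h1] with i hi
    have h2 : lpDist p (μ i) ((o i).embed (α i) (hα.isometry i)).1
        (fun x => (0 : C(M₀, 𝔹)) (φ i x)) < B + 1 := by
      rcases hi with ⟨s, hs, h⟩ | ⟨_, -, h⟩
      · cases h; exact hs.2
      · cases h
    have h3 : lpDist p (μ i) (u i).1 (o i).1 ≤ b := hb i
    rw [← LpMap.lpDist_embed (hα.isometry i)] at h3
    rw [lpDist_eq_eLpNorm hp0] at h2 h3
    have h4 := eLpNorm_sub_le_add ((u i).embed (α i) (hα.isometry i)).1.aestronglyMeasurable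
      ((o i).embed (α i) (hα.isometry i)).1.aestronglyMeasurable
      (aestronglyMeasurable_const (b := (0 : 𝔹))) hp
    simp only [ContinuousMap.zero_apply, sub_zero] at h2 h4
    rw [ENNReal.coe_add, ENNReal.coe_toNNReal (by finiteness)]
    exact h4.trans (add_le_add h3 h2.le)
  obtain ⟨v, hv, happ⟩ := hφ.exists_strong_limit hp hU
    (fun i => ((u i).embed (α i) (hα.isometry i)).1.aestronglyMeasurable)
    fun ε hε => exists_continuous_approx hφ hα hp hc hC hR hf hcov hρ hP hU u hEU hb' hε
  have hrange := hα.ae_mem_range_of_strong_limit hφ hp hU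
    (fun i => ((u i).embed (α i) (hα.isometry i)).1.aestronglyMeasurable)
    (fun i => by
      filter_upwards [(u i).coeFn_embed (hα.isometry i)] with x hx
      rw [hx, sub_add_cancel]
      exact ⟨_, rfl⟩) hv.1 happ
  obtain ⟨u₀, hu₀⟩ := LpMap.exists_embed_ae_eq hp0 hα.isometry₀ hv hrange
  have hlim := hφ.tendsto_banachLpTopology hp hU
    (fun i => (u i).embed (α i) (hα.isometry i)) (u₀.embed α₀ hα.isometry₀) fun ε hε => by
      obtain ⟨g, hg1, hg2⟩ := happ ε hε
      refine ⟨g, le_of_eq_of_le (eLpNorm_congr_ae ?_) hg1, hg2⟩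
      filter_upwards [hu₀] with x hx
      rw [hx]
  obtain ⟨J, hJ1, hJ2, hJ3, h, hh⟩ := exists_net_tendsto_filter (U : Filter I)
  refine ⟨J, hJ1, hJ2, hJ3, h, u₀, hh.mono_right hU, ?_⟩
  rw [tendsto_nhds_induced_iff]
  exact hlim.comp hh
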